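/- **Gauss diagrams and virtual links.** A ($2$-component) Gauss diagram $G$ consists of two ordered, oriented circles $C_1,C_2$ together with finitely many signed (by $\pm1$) and oriented chords whose endpoints are distinct points of $C_1\cup C_2$, considered up to orientation-preserving homeomorphism of each circle. A chord is a self-chord if both of its endpoints lie on the same circle, and a nonself-chord of type $(i,j)$, $i\neq j$, if it is oriented from $C_i$ to $C_j$. A $2$-component (ordered, oriented) virtual link $L=K_1\cup K_2$ is an equivalence class of Gauss diagrams under the Reidemeister moves R1 (adding or deleting a chord with adjacent endpoints), R2 (adding or deleting two chords of opposite signs whose initial endpoints are adjacent and whose terminal endpoints are adjacent) and R3 (all oriented versions of the third Reidemeister move). A $\Xi$-move exchanges the positions of $P_1$ and $P_3$ for three consecutive endpoints $P_1,P_2,P_3$ of chords on a circle, keeping signs and orientations of chords; $P_1,P_2,P_3$ may include both endpoints of one chord. Two virtual links are related by a $\Xi$-move if they have Gauss diagrams that are. $L$ is *even* if the number of nonself-chords in a Gauss diagram of $L$ is even (this does not depend on the diagram). **Invariants.** Let $L$ be even and let $G$ be a Gauss diagram of $L$. * A self-chord of $C_i$ is *odd* if the number of endpoints of chords in the interior of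 one of the two arcs into which its endpoints divide $C_i$ is odd. The *odd writhe* $J(K_i;L)$, $i=1,2$, is the sum of the signs of all odd self-chords of $C_i$. * Two nonself-chords $\gamma,\gamma'$ are *equivalent* if $\gamma=\gamma'$ or the total number of endpoints of chords in the interiors of $\alpha$ and $\beta$ is even, where $\alpha\subset C_1$ is one of the two arcs bounded by the endpoints of $\gamma,\gamma'$ on $C_1$, and $\beta\subset C_2$ one of the two arcs bounded by their endpoints on $C_2$. (As $L$ is even, neither notion depends on the choice of the arcs.) * Fix a nonself-chord $\gamma_0$. For $(i,j)=(1,2),(2,1)$ let $\sigma_{ij}$ be the sum of the signs of the nonself-chords of type $(i,j)$ equivalent to $\gamma_0$ (including $\gamma_0$ itself), and $\tau_{ij}$ the sum of the signs of those not equivalent to $\gamma_0$. On $(\mathbb Z\times\mathbb Z)^2$ let $\doteq$ be the equivalence relation under which $((p,q),(r,s))$ is equivalent exactly to itself and to $((q,p),(s,r))$. The *reduced linking class* $\overline F(L)$ is the class of $((\sigma_{12},\tau_{12}),(\sigma_{21},\tau_{21}))$ in $(\mathbb Z\times\mathbb Z)^2/\doteq$; if $G$ has no nonself-chord, it is the class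 of $((0,0),(0,0))$. **Theorem.** Let $L=K_1\cup K_2$ and $L'=K_1'\cup K_2'$ be $2$-component even virtual links, and compute the invariants above from arbitrary Gauss diagrams of $L$ and $L'$ and arbitrary nonself-chords $\gamma_0,\gamma_0'$ in them. Then the following are equivalent: 1. $L$ and $L'$ are related by a finite sequence of $\Xi$-moves; 2. $J(K_1;L)=J(K_1';L')$, $J(K_2;L)=J(K_2';L')$ and $\overline F(L)=\overline F(L')$. (In particular, with $L=L'$, the invariants do not depend on the choices.) -/

import Mathlib

/-- An endpoint of a signed, oriented chord: the name of the chord, whether the endpoint is the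
initial (over-crossing) or the terminal (under-crossing) one, and the sign of the chord. -/
structure Endpoint where
  chord : ℕ
  isOver : Bool
  sign : ℤˣ
deriving DecidableEq

/-- The other endpoint of the same chord. -/
def Endpoint.mate (e : Endpoint) : Endpoint := ⟨e.chord, !e.isOver, e.sign⟩

/-- Change of the name of the chord. -/
def Endpoint.rename (f : Equiv.Perm ℕ) (e : Endpoint) : Endpoint := ⟨f e.chord, e.isOver, e.sign⟩

/-- A Gauss diagram on two ordered oriented circles `C₁` (index `0`) and `C₂` (index `1`).
Each circle is cut at a base point lying off the endpoints, and is given by the list of the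
endpoints met when travelling once along the circle. Every endpoint occurs once, and together
with an endpoint the other endpoint of its chord occurs, with the same sign. Base points and names
of chords carry no information: see `GaussDiagram.Iso`. -/
structure GaussDiagram where
  circle : Fin 2 → List Endpoint
  nodup : ((circle 0 ++ circle 1).map fun e => (e.chord, e.isOver)).Nodup
  mate_mem : ∀ e ∈ circle 0 ++ circle 1, e.mate ∈ circle 0 ++ circle 1

namespace GaussDiagram

/-- Two codes of the same Gauss diagram: they differ by the names of the chords and by the
base points on the circles. -/
def Iso (D D' : GaussDiagram) : Prop :=
  ∃ f : Equiv.Perm ℕ, ∀ i, ((D.circle i).map (Endpoint.rename f)).IsRotated (D'.circle i)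

/-- Travelling along a circle, one meets `x` and, immediately after it, `y`
(without passing the base point in between). -/
def Consec (D : GaussDiagram) (x y : Endpoint) : Prop :=
  ∃ i l r, D.circle i = l ++ x :: y :: r

/-- `x` and `y` are consecutive, in this order if `ε = 1` and in the opposite one if `ε = -1`. -/
def ConsecOrd (D : GaussDiagram) (ε : ℤˣ) (x y : Endpoint) : Prop :=
  (ε = 1 ∧ D.Consec x y) ∨ (ε = -1 ∧ D.Consec y x)

/-- R1: `D'` has a free chord (of any sign and orientation), and `D` is `D'` without it. -/
def R1 (D D' : GaussDiagram) : Prop :=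
  ∃ e, D'.Consec e e.mate ∧
    ∀ i, D.circle i = (D'.circle i).filter fun x => x.chord ≠ e.chord

/-- R2: `D'` has two chords of opposite signs, whose initial endpoints are consecutive and whose
terminal endpoints are consecutive, in either order; `D` is `D'` without these two chords. -/
def R2 (D D' : GaussDiagram) : Prop :=
  ∃ e f, e.isOver = true ∧ f.isOver = true ∧ f.sign = -e.sign ∧ D'.Consec e f ∧
    (D'.Consec e.mate f.mate ∨ D'.Consec f.mate e.mate) ∧
    ∀ i, D.circle i = (D'.circle i).filter fun x => x.chord ≠ e.chord ∧ x.chord ≠ f.chord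

/-- R3, all of its oriented versions. Three strands `T`, `M`, `B` (top, middle, bottom) cross
pairwise: `a` is the crossing of `T` over `M`, `b` that of `T` over `B`, and `c` that of `M` over
`B` (each given by its initial endpoint). The move reverses the order of the two crossings on
each strand. `εT = 1` if `T` meets `a` before `b`, `εM = 1` if `M` meets `a` before `c`, `εB = 1`
if `B` meets `b` before `c`. For three oriented lines in the plane the sign of each crossing is,
up to one common factor `δ = ±1`, the order on the strand that does not pass through it, and all
sixteen such configurations occur. -/
def R3 (D D' : GaussDiagram) : Prop :=
  ∃ (a b c : Endpoint) (εT εM εB δ : ℤˣ),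
    a.isOver = true ∧ b.isOver = true ∧ c.isOver = true ∧
    a.chord ≠ b.chord ∧ a.chord ≠ c.chord ∧ b.chord ≠ c.chord ∧
    D.ConsecOrd εT a b ∧ D.ConsecOrd εM a.mate c ∧ D.ConsecOrd εB b.mate c.mate ∧
    a.sign = δ * εB ∧ b.sign = δ * εM ∧ c.sign = δ * εT ∧
    ∀ i, D'.circle i = (D.circle i).map
      (Equiv.swap a b ∘ Equiv.swap a.mate c ∘ Equiv.swap b.mate c.mate)

/-- Ξ-move: for three consecutive endpoints on a circle (of chords of any signs and
orientations, possibly two of them of one chord), exchange the first and the last. -/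
def Xi (D D' : GaussDiagram) : Prop :=
  ∃ i l r p₁ p₂ p₃, D.circle i = l ++ p₁ :: p₂ :: p₃ :: r ∧
    D'.circle = Function.update D.circle i (l ++ p₃ :: p₂ :: p₁ :: r)

/-- Two codes of one Gauss diagram, or two Gauss diagrams related by one Reidemeister move. -/
def Reidemeister (D D' : GaussDiagram) : Prop :=
  D.Iso D' ∨ D.R1 D' ∨ D.R2 D' ∨ D.R3 D'

/-- The equivalence relation generated by the Reidemeister moves. -/
def reidemeisterSetoid : Setoid GaussDiagram := Relation.EqvGen.setoid Reidemeister

/-- The chords oriented from circle `i` to circle `j`, each given by its initial endpoint. For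
`i = j` these are the self-chords of circle `i`; for `i ≠ j` the nonself-chords of type `(i, j)`. -/
def chords (D : GaussDiagram) (i j : Fin 2) : List Endpoint :=
  (D.circle i).filter fun e => e.isOver = true ∧ e.mate ∈ D.circle j

/-- The nonself-chords. -/
def nonself (D : GaussDiagram) : List Endpoint := D.chords 0 1 ++ D.chords 1 0

/-- The number of nonself-chords is even. -/
def IsEven (D : GaussDiagram) : Prop := Even D.nonself.length

/-- The number of endpoints on the open arc of circle `i` that is bounded by the endpoints `x` and
`y` and avoids the base point (`0` if `x = y`). -/
def arc (D : GaussDiagram) (i : Fin 2) (x y : Endpoint) : ℕ :=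
  max ((D.circle i).idxOf x) ((D.circle i).idxOf y)
    - min ((D.circle i).idxOf x) ((D.circle i).idxOf y) - 1

/-- The odd writhe of the `i`-th component: the sum of the signs of its odd self-chords. In an even
diagram the parity of a self-chord can be read off from either of its two arcs. -/
def oddWrithe (D : GaussDiagram) (i : Fin 2) : ℤ :=
  (((D.chords i i).filter fun e => Odd (D.arc i e e.mate)).map fun e => (e.sign : ℤ)).sum

/-- The endpoint on circle `i` of the nonself-chord with initial endpoint `e`. -/
def foot (D : GaussDiagram) (i : Fin 2) (e : Endpoint) : Endpoint :=
  if e ∈ D.circle i then e else e.mate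

/-- Equivalence of two nonself-chords: the total number of endpoints on an arc of `C₁` and an arc of
`C₂` between them is even. In an even diagram any choice of the arcs gives the same answer. -/
def ChordEquiv (D : GaussDiagram) (e f : Endpoint) : Prop :=
  Even (D.arc 0 (D.foot 0 e) (D.foot 0 f) + D.arc 1 (D.foot 1 e) (D.foot 1 f))

instance (D : GaussDiagram) (e f : Endpoint) : Decidable (D.ChordEquiv e f) :=
  inferInstanceAs (Decidable (Even _))

/-- The sum of the signs of the nonself-chords of type `(i, j)` equivalent to `γ`. -/
def sigma (D : GaussDiagram) (γ : Endpoint) (i j : Fin 2) : ℤ :=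
  (((D.chords i j).filter fun e => D.ChordEquiv e γ).map fun e => (e.sign : ℤ)).sum

/-- The sum of the signs of the nonself-chords of type `(i, j)` not equivalent to `γ`. -/
def tau (D : GaussDiagram) (γ : Endpoint) (i j : Fin 2) : ℤ :=
  (((D.chords i j).filter fun e => ¬ D.ChordEquiv e γ).map fun e => (e.sign : ℤ)).sum

end GaussDiagram

/-- The relation `≐` on `(ℤ × ℤ)²`: equality up to swapping the entries of both pairs. -/
def dotSetoid : Setoid ((ℤ × ℤ) × (ℤ × ℤ)) where
  r x y := x = y ∨ x = (y.1.swap, y.2.swap)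
  iseqv :=
    { refl := fun _ => Or.inl rfl
      symm := by
        rintro x y (rfl | rfl)
        · exact Or.inl rfl
        · exact Or.inr (by simp)
      trans := by
        rintro x y z (rfl | rfl) (rfl | rfl)
        · exact Or.inl rfl
        · exact Or.inr rfl
        · exact Or.inr rfl
        · exact Or.inl (by simp) }

/-- The set `(ℤ × ℤ)² / ≐`. -/
def LinkingClass : Type := Quotient dotSetoid

/-- The class `[(p, q), (r, s)]`. -/
def LinkingClass.mk (x : (ℤ × ℤ) × (ℤ × ℤ)) : LinkingClass := Quotient.mk dotSetoid x

/-- `F` is the reduced linking class of the diagram `D`, computed from some nonself-chord `γ`. If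
there is no nonself-chord, all sums are empty and the class is `[(0, 0), (0, 0)]`. -/
def GaussDiagram.IsReducedLinkingClass (D : GaussDiagram) (F : LinkingClass) : Prop :=
  (∃ γ ∈ D.nonself,
    F = LinkingClass.mk ((D.sigma γ 0 1, D.tau γ 0 1), (D.sigma γ 1 0, D.tau γ 1 0))) ∨
  (D.nonself = [] ∧ F = LinkingClass.mk ((0, 0), (0, 0)))

/-- Ordered oriented 2-component virtual links: Gauss diagrams up to Reidemeister moves. -/
def VirtualLink : Type := Quotient GaussDiagram.reidemeisterSetoid

/-- `D` is a Gauss diagram of the virtual link `L`. -/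
def GaussDiagram.Represents (D : GaussDiagram) (L : VirtualLink) : Prop :=
  Quotient.mk GaussDiagram.reidemeisterSetoid D = L

namespace VirtualLink

/-- A virtual link is even if it has an even Gauss diagram. (Reidemeister moves preserve the parity
of the number of nonself-chords, so all its Gauss diagrams are then even.) -/
def IsEven (L : VirtualLink) : Prop := ∃ D : GaussDiagram, D.Represents L ∧ D.IsEven

/-- `L` and `L'` have Gauss diagrams related by one Ξ-move. -/
def XiMove (L L' : VirtualLink) : Prop :=
  ∃ D D' : GaussDiagram, D.Represents L ∧ D'.Represents L' ∧ D.Xi D'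

/-- `L` and `L'` are related by a finite sequence of Ξ-moves. -/
def XiEquiv (L L' : VirtualLink) : Prop := Relation.ReflTransGen XiMove L L'

end VirtualLink

/-!
Up to Ξ-moves only the parity of the position of an endpoint on its circle matters: exchanging the
outer two of three consecutive endpoints generates all permutations of the even positions and all
permutations of the odd positions of a circle. A position is therefore remembered as a *slot*, a
circle together with a parity, a chord as an *arrow* between two slots with a sign, and a diagram
as the multiset of its arrows, its *type* (`GaussDiagram.type`). Diagrams with the same type are
equivalent (`GaussDiagram.equivalent_of_type_eq`).

Write `x̄` for the other slot on the circle of `x`. On types, R1 adds an arrow `x → x̄`, R2 adds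
`x → y` and `x̄ → ȳ` with opposite signs, R3 replaces three arrows `x → y` by `x̄ → ȳ`, and moving a
base point of an even diagram exchanges the two slots of a circle. The class of an arrow consists of
its two circles and the sum of its two parities. The sums of the signs over the classes, other than
those of R1, are invariant, up to a simultaneous shift of the two classes from one circle to the
other caused by moving base points (`GaussDiagram.Equivalent.sameInvariants`). These sums are the
odd writhes and the reduced linking class (`GaussDiagram.oddWrithe_eq`,
`GaussDiagram.IsReducedLinkingClass.eq`).

Conversely, consider the abelian group generated by all arrows modulo the multisets that the
Reidemeister moves create. R2 turns `x̄ → ȳ` into minus the arrow `x → y` of the opposite sign, so it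
is generated by one arrow for each class together with the sums `N(x, y)` of the two arrows from
`x` to `y`. R1 and R3 give `N(x, x̄) = 0` and `N(t, m) + N(t̄, u) = N(m, u)`, by which every `N(x, y)`
is a combination of only two of them. In the type of an even diagram the coefficients of these two
are determined by the others, because each circle has as many endpoints in even as in odd
positions. Hence the class of the type in the group is determined by the sums of signs
(`GaussDiagram.map_eq_map`). Equality in the group means equality of types after creating chords in
both diagrams (`GaussDiagram.exists_add_eq_add`), and chords can be created in any slots
(`GaussDiagram.exists_add_of_mem_closure`), so the diagrams are equivalent.
-/

/-! ### Parities of positions in a list -/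

section ListParity

variable {α : Type*}

theorem ZMod.two_eq_zero : (2 : ZMod 2) = 0 := rfl

theorem List.idxOf_append_cons_self [DecidableEq α] {l r : List α} {x : α} (h : x ∉ l) :
    (l ++ x :: r).idxOf x = l.length := by
  rw [List.idxOf_append_of_notMem h, List.idxOf_cons_self, Nat.add_zero]

theorem List.idxOf_adjacent [DecidableEq α] {l r : List α} {x y : α} (h : (l ++ x :: y :: r).Nodup) :
    (l ++ x :: y :: r).idxOf y = (l ++ x :: y :: r).idxOf x + 1 := by
  have hx : x ∉ l := by grind
  have hy : y ∉ l := by grind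
  have hxy : x ≠ y := by grind
  rw [List.idxOf_append_cons_self hx, List.idxOf_append_of_notMem hy, List.idxOf_cons_ne _ hxy,
    List.idxOf_cons_self]

/-- Parities of positions are unchanged when two adjacent entries are deleted. -/
theorem List.idxOf_delete_adjacent [DecidableEq α] {l r : List α} {x y z : α} (hx : z ≠ x) (hy : z ≠ y) :
    ((l ++ r).idxOf z : ZMod 2) = (l ++ x :: y :: r).idxOf z := by
  by_cases h : z ∈ l
  · rw [List.idxOf_append_of_mem h, List.idxOf_append_of_mem h]
  · rw [List.idxOf_append_of_notMem h, List.idxOf_append_of_notMem h,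
      List.idxOf_cons_ne _ hx.symm, List.idxOf_cons_ne _ hy.symm]
    push_cast
    linear_combination -ZMod.two_eq_zero

/-- The entries `x` and `y` are adjacent in `l`, in either order, or both are absent from it. -/
def List.AdjOrAbsent (l : List α) (x y : α) : Prop :=
  (∃ l₁ l₂, l = l₁ ++ x :: y :: l₂) ∨ (∃ l₁ l₂, l = l₁ ++ y :: x :: l₂) ∨ (x ∉ l ∧ y ∉ l)

theorem List.AdjOrAbsent.filter {l : List α} {x y : α} (h : l.AdjOrAbsent x y) {p : α → Bool}
    (hx : p x) (hy : p y) : (l.filter p).AdjOrAbsent x y := by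
  rcases h with ⟨l₁, l₂, rfl⟩ | ⟨l₁, l₂, rfl⟩ | ⟨h₁, h₂⟩
  · exact Or.inl ⟨l₁.filter p, l₂.filter p, by simp [hx, hy]⟩
  · exact Or.inr (Or.inl ⟨l₁.filter p, l₂.filter p, by simp [hx, hy]⟩)
  · exact Or.inr (Or.inr ⟨by simp [h₁], by simp [h₂]⟩)

theorem List.AdjOrAbsent.idxOf_filter [DecidableEq α] {l : List α} {x y : α} (h : l.AdjOrAbsent x y)
    (hl : l.Nodup) {z : α} (hx : z ≠ x) (hy : z ≠ y) :
    ((l.filter fun w => w ≠ x ∧ w ≠ y).idxOf z : ZMod 2) = l.idxOf z := by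
  rcases h with ⟨l₁, l₂, rfl⟩ | ⟨l₁, l₂, rfl⟩ | ⟨h₁, h₂⟩
  · rw [← List.idxOf_delete_adjacent hx hy]
    congr 2
    rw [List.filter_append, List.filter_cons_of_neg (by simp), List.filter_cons_of_neg (by simp),
      List.filter_eq_self.2, List.filter_eq_self.2] <;> grind
  · rw [← List.idxOf_delete_adjacent hy hx]
    congr 2
    rw [List.filter_append, List.filter_cons_of_neg (by simp), List.filter_cons_of_neg (by simp),
      List.filter_eq_self.2, List.filter_eq_self.2] <;> grind
  · rw [List.filter_eq_self.2]
    grind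

theorem List.AdjOrAbsent.length_filter [DecidableEq α] {l : List α} {x y : α} (h : l.AdjOrAbsent x y)
    (hl : l.Nodup) :
    ((l.filter fun w => w ≠ x ∧ w ≠ y).length : ZMod 2) = l.length := by
  rcases h with ⟨l₁, l₂, rfl⟩ | ⟨l₁, l₂, rfl⟩ | ⟨h₁, h₂⟩
  · rw [List.filter_append, List.filter_cons_of_neg (by simp), List.filter_cons_of_neg (by simp),
      List.filter_eq_self.2, List.filter_eq_self.2]
    · simp only [List.length_append, List.length_cons]
      push_cast
      linear_combination -ZMod.two_eq_zero
    all_goals grind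
  · rw [List.filter_append, List.filter_cons_of_neg (by simp), List.filter_cons_of_neg (by simp),
      List.filter_eq_self.2, List.filter_eq_self.2]
    · simp only [List.length_append, List.length_cons]
      push_cast
      linear_combination -ZMod.two_eq_zero
    all_goals grind
  · rw [List.filter_eq_self.2]
    grind

theorem List.AdjOrAbsent.idxOf_succ [DecidableEq α] {l : List α} {x y : α} (h : l.AdjOrAbsent x y)
    (hl : l.Nodup) (hx : x ∈ l) : y ∈ l ∧ (l.idxOf y : ZMod 2) = l.idxOf x + 1 := by
  rcases h with ⟨l₁, l₂, rfl⟩ | ⟨l₁, l₂, rfl⟩ | ⟨h₁, h₂⟩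
  · refine ⟨by simp, ?_⟩
    rw [List.idxOf_adjacent hl]
    push_cast
    rfl
  · refine ⟨by simp, ?_⟩
    rw [List.idxOf_adjacent hl]
    push_cast
    linear_combination -ZMod.two_eq_zero
  · exact absurd hx h₁

theorem List.idxOf_map_equiv [DecidableEq α] (σ : Equiv.Perm α) (l : List α) (x : α) :
    (l.map σ).idxOf x = l.idxOf (σ.symm x) := by
  induction l with
  | nil => rfl
  | cons a l ih =>
    rw [List.map_cons, List.idxOf_cons, List.idxOf_cons, ih]
    by_cases h : σ a = x
    · subst h
      simp [Bool.cond_eq_ite]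
    · have : a ≠ σ.symm x := fun h' => h (by simp [h'])
      simp [h, this, Bool.cond_eq_ite]

/-- In a list of even length, a rotation shifts all parities of positions by the same amount. -/
theorem List.idxOf_rotate_parity [DecidableEq α] {l : List α} (hl : l.Nodup) (he : Even l.length) (n : ℕ) {x : α}
    (hx : x ∈ l) : ((l.rotate n).idxOf x : ZMod 2) = l.idxOf x + n := by
  induction n generalizing l with
  | zero => simp
  | succ n ih =>
    cases l with
    | nil => simp at hx
    | cons a l =>
      have hn : (l ++ [a]).Nodup := by grind
      rw [List.rotate_cons_succ, ih hn (by simpa using he) (by grind)]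
      have hlen : (((a :: l).length : ℕ) : ZMod 2) = 0 := by
        rw [ZMod.natCast_eq_zero_iff]
        exact he.two_dvd
      rw [List.length_cons] at hlen
      push_cast at hlen ⊢
      by_cases h : x = a
      · subst h
        have : x ∉ l := by grind
        rw [List.idxOf_append_cons_self this, List.idxOf_cons_self]
        push_cast
        linear_combination hlen - ZMod.two_eq_zero
      · have : x ∈ l := by grind
        rw [List.idxOf_append_of_mem this, List.idxOf_cons_ne _ (Ne.symm h)]
        push_cast
        linear_combination -ZMod.two_eq_zero

/-- Exchange of the first and the last of three consecutive entries. -/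
def List.SwapOuter (l l' : List α) : Prop :=
  ∃ k r p₁ p₂ p₃, l = k ++ p₁ :: p₂ :: p₃ :: r ∧ l' = k ++ p₃ :: p₂ :: p₁ :: r

theorem List.SwapOuter.perm {l l' : List α} (h : l.SwapOuter l') : l.Perm l' := by
  obtain ⟨k, r, p₁, p₂, p₃, rfl, rfl⟩ := h
  refine List.Perm.append_left k ?_
  exact ((List.Perm.swap _ _ _).trans ((List.Perm.swap _ _ _).cons _)).trans (List.Perm.swap _ _ _)

theorem List.SwapOuter.symm {l l' : List α} (h : l.SwapOuter l') : l'.SwapOuter l := by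
  obtain ⟨k, r, p₁, p₂, p₃, rfl, rfl⟩ := h
  exact ⟨k, r, p₃, p₂, p₁, rfl, rfl⟩

theorem List.SwapOuter.idxOf [DecidableEq α] {l l' : List α} (h : l.SwapOuter l') (hl : l.Nodup) (x : α) :
    (l'.idxOf x : ZMod 2) = l.idxOf x := by
  obtain ⟨k, r, p₁, p₂, p₃, rfl, rfl⟩ := h
  by_cases hk : x ∈ k
  · rw [List.idxOf_append_of_mem hk, List.idxOf_append_of_mem hk]
  · have h12 : p₁ ≠ p₂ := by grind
    have h13 : p₁ ≠ p₃ := by grind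
    have h23 : p₂ ≠ p₃ := by grind
    rw [List.idxOf_append_of_notMem hk, List.idxOf_append_of_notMem hk]
    simp only [List.idxOf_cons, Bool.cond_eq_ite, beq_iff_eq]
    by_cases h1 : p₁ = x
    · subst h1
      simp [h12.symm, h13.symm, ZMod.two_eq_zero]
    · by_cases h3 : p₃ = x
      · subst h3
        simp [h13, h23, ZMod.two_eq_zero]
      · simp [h1, h3]

theorem List.SwapOuter.append_left {l l' : List α} (k : List α) (h : l.SwapOuter l') :
    (k ++ l).SwapOuter (k ++ l') := by
  obtain ⟨k', r, p₁, p₂, p₃, rfl, rfl⟩ := h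
  exact ⟨k ++ k', r, p₁, p₂, p₃, by simp, by simp⟩

/-- An entry in an even position can be moved to the front by exchanges. -/
theorem List.exists_swapOuter_front [DecidableEq α] (n : ℕ) : ∀ {l : List α} {x : α}, l.length ≤ n → x ∈ l →
    (l.idxOf x : ZMod 2) = 0 → ∃ t, Relation.ReflTransGen List.SwapOuter l (x :: t) := by
  induction n using Nat.strong_induction_on with
  | _ n ih =>
    intro l x hn hx h0
    match l, hx with
    | a :: l, hx =>
      by_cases ha : a = x
      · exact ⟨l, ha ▸ .refl⟩
      · have hxl : x ∈ l := by grind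
        rw [List.idxOf_cons_ne _ ha] at h0
        match l, hxl with
        | b :: l, hxl =>
          by_cases hb : b = x
          · subst hb
            simp at h0
          · have hx' : x ∈ l := by grind
            rw [List.idxOf_cons_ne _ hb] at h0
            simp only [List.length_cons] at hn
            obtain ⟨t, ht⟩ := ih (n - 2) (by omega) (l := l) (x := x) (by omega) hx' (by
              push_cast at h0
              linear_combination h0 - ZMod.two_eq_zero)
            refine ⟨b :: a :: t, ?_⟩
            have h1 : Relation.ReflTransGen List.SwapOuter (a :: b :: l) (a :: b :: x :: t) :=
              ht.lift (fun l => [a, b] ++ l) fun _ _ h => List.SwapOuter.append_left _ h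
            exact h1.tail ⟨[], t, a, b, x, rfl, rfl⟩

/-- Exchanges connect any two arrangements of the same entries with the same parities of
positions. -/
theorem List.swapOuter_of_parity [DecidableEq α] {l l' : List α} (hl : l.Nodup) (hp : l.Perm l')
    (h : ∀ x ∈ l, (l'.idxOf x : ZMod 2) = l.idxOf x) :
    Relation.ReflTransGen List.SwapOuter l l' := by
  induction l' generalizing l with
  | nil => rw [hp.eq_nil]
  | cons x t' ih =>
    have hx : x ∈ l := hp.mem_iff.2 (by simp)
    obtain ⟨t, ht⟩ := List.exists_swapOuter_front l.length le_rfl hx (by rw [← h x hx]; simp)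
    have key : ∀ {m : List α}, Relation.ReflTransGen List.SwapOuter l m →
        l.Perm m ∧ ∀ y, (m.idxOf y : ZMod 2) = l.idxOf y := by
      intro m hm
      induction hm with
      | refl => exact ⟨List.Perm.refl _, fun _ => rfl⟩
      | tail _ hs ih =>
        exact ⟨ih.1.trans hs.perm, fun y =>
          (hs.idxOf ((ih.1.nodup_iff).1 hl) y).trans (ih.2 y)⟩
    obtain ⟨hpt, hidx⟩ := key ht
    have hnd := (hpt.nodup_iff).1 hl
    have htt : t.Perm t' := (List.perm_cons x).1 (hpt.symm.trans hp)
    refine ht.trans (Relation.ReflTransGen.lift (fun l => [x] ++ l)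
      (fun _ _ h => List.SwapOuter.append_left _ h) t t' (ih (List.nodup_cons.1 hnd).2 htt ?_))
    intro y hy
    have hyx : x ≠ y := fun e => (List.nodup_cons.1 hnd).1 (e ▸ hy)
    have := (h y (hpt.mem_iff.2 (by simp [hy]))).trans (hidx y).symm
    rw [List.idxOf_cons_ne _ hyx, List.idxOf_cons_ne _ hyx] at this
    push_cast at this
    exact add_right_cancel this

/-- Two repetition-free lists of equal length are matched by a permutation. -/
theorem List.exists_perm_map_eq [DecidableEq α] {l l' : List α} (hl : l.Nodup) (hl' : l'.Nodup)
    (h : l.length = l'.length) : ∃ f : Equiv.Perm α, l.map f = l' := by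
  induction l generalizing l' with
  | nil => exact ⟨1, by simp [List.length_eq_zero_iff.1 h.symm]⟩
  | cons a l ih =>
    match l', h with
    | a' :: l', h =>
      obtain ⟨f, hf⟩ := ih (List.nodup_cons.1 hl).2 (List.nodup_cons.1 hl').2 (by simpa using h)
      refine ⟨f.trans (Equiv.swap (f a) a'), ?_⟩
      rw [List.map_cons]
      congr 1
      · simp
      · rw [← hf]
        refine List.map_congr_left fun x hx => ?_
        rw [Equiv.trans_apply, Equiv.swap_apply_of_ne_of_ne]
        · intro e
          exact (List.nodup_cons.1 hl).1 (f.injective e ▸ hx)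
        · rintro rfl
          exact (List.nodup_cons.1 hl').1 (hf ▸ List.mem_map_of_mem hx)

theorem List.sum_map_idxOf_neg_one [DecidableEq α] {l : List α} (hl : l.Nodup) (he : Even l.length) :
    (l.map fun x => (-1 : ℤ) ^ l.idxOf x).sum = 0 := by
  have h1 : l.map (fun x => l.idxOf x) = List.range l.length := by
    apply List.ext_getElem
    · simp
    · intro i h1 h2
      simp [hl.idxOf_getElem]
  have h2 : (l.map fun x => (-1 : ℤ) ^ l.idxOf x) = (List.range l.length).map ((-1 : ℤ) ^ ·) := by
    rw [← h1, List.map_map]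
    rfl
  rw [h2, ← List.sum_toFinset _ List.nodup_range, List.toFinset_range, neg_one_geom_sum, if_pos he]

end ListParity

/-! ### Slots and arrows -/

/-- A circle together with a parity. A slot stands for the positions of this parity on this
circle. -/
abbrev Slot : Type := Fin 2 × ZMod 2

/-- The slot on the same circle with the other parity. -/
def Slot.bar (x : Slot) : Slot := (x.1, x.2 + 1)

@[simp] theorem Slot.bar_fst (x : Slot) : x.bar.1 = x.1 := rfl

@[simp] theorem Slot.bar_snd (x : Slot) : x.bar.2 = x.2 + 1 := rfl

@[simp] theorem Slot.bar_bar (x : Slot) : x.bar.bar = x := by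
  revert x; decide

/-- The slot of the initial endpoint of a chord, that of its terminal endpoint, and its sign. -/
abbrev Arrow : Type := Slot × Slot × ℤˣ

@[simp] theorem Endpoint.mate_chord (e : Endpoint) : e.mate.chord = e.chord := rfl

@[simp] theorem Endpoint.mate_isOver (e : Endpoint) : e.mate.isOver = !e.isOver := rfl

@[simp] theorem Endpoint.mate_sign (e : Endpoint) : e.mate.sign = e.sign := rfl

@[simp] theorem Endpoint.mate_mate (e : Endpoint) : e.mate.mate = e := by
  simp [Endpoint.mate]

theorem Endpoint.mate_ne (e : Endpoint) : e.mate ≠ e := by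
  intro h
  have := congrArg Endpoint.isOver h
  simp at this

theorem Endpoint.mate_injective : Function.Injective Endpoint.mate :=
  Function.LeftInverse.injective Endpoint.mate_mate

theorem Endpoint.ext' {e f : Endpoint} (h₁ : e.chord = f.chord) (h₂ : e.isOver = f.isOver)
    (h₃ : e.sign = f.sign) : e = f := by
  cases e; cases f; simp_all

/-- The slot occupied by `e` when `C` gives the two circles. It is meaningful for endpoints lying
on one of the circles. -/
def slotOf (C : Fin 2 → List Endpoint) (e : Endpoint) : Slot :=
  if e ∈ C 0 then (0, ((C 0).idxOf e : ℕ)) else (1, ((C 1).idxOf e : ℕ))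

namespace GaussDiagram

variable (D : GaussDiagram)

/-- The endpoints of all chords. -/
def ends : Finset Endpoint := (D.circle 0 ++ D.circle 1).toFinset

/-- The initial endpoints of all chords. -/
def overs : Finset Endpoint := D.ends.filter fun e => e.isOver = true

/-- The slot of an endpoint of `D`. -/
def slot (e : Endpoint) : Slot := slotOf D.circle e

/-- The arrow of the chord with initial endpoint `e`. -/
def arrow (e : Endpoint) : Arrow := (D.slot e, D.slot e.mate, e.sign)

/-- The multiset of the arrows of all chords. It forgets the order of the endpoints within each
slot, which is the information destroyed by Ξ-moves. -/
def type : Multiset Arrow := D.overs.val.map D.arrow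

variable {D}

theorem mem_ends {e : Endpoint} : e ∈ D.ends ↔ ∃ i, e ∈ D.circle i := by
  simp [ends, Fin.exists_fin_two]

theorem mem_ends_of_mem {e : Endpoint} {i : Fin 2} (h : e ∈ D.circle i) : e ∈ D.ends :=
  mem_ends.2 ⟨i, h⟩

theorem mem_overs {e : Endpoint} : e ∈ D.overs ↔ e ∈ D.ends ∧ e.isOver = true := by
  simp [overs]

theorem nodup_append (D : GaussDiagram) : (D.circle 0 ++ D.circle 1).Nodup :=
  List.Nodup.of_map _ D.nodup

theorem circle_nodup (D : GaussDiagram) (i : Fin 2) : (D.circle i).Nodup := by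
  have := List.nodup_append.1 D.nodup_append
  fin_cases i
  · exact this.1
  · exact this.2.1

theorem circle_unique {e : Endpoint} {i j : Fin 2} (hi : e ∈ D.circle i) (hj : e ∈ D.circle j) :
    i = j := by
  have := (List.nodup_append.1 D.nodup_append).2.2
  fin_cases i <;> fin_cases j
  · rfl
  · exact absurd rfl (this e hi e hj)
  · exact absurd rfl (this e hj e hi)
  · rfl

theorem mate_mem_ends {e : Endpoint} (h : e ∈ D.ends) : e.mate ∈ D.ends := by
  simp only [ends, List.mem_toFinset] at h ⊢
  exact D.mate_mem e h

theorem eq_of_chord_eq {e f : Endpoint} (he : e ∈ D.ends) (hf : f ∈ D.ends)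
    (h : e.chord = f.chord) (h' : e.isOver = f.isOver) : e = f := by
  simp only [ends, List.mem_toFinset] at he hf
  exact List.inj_on_of_nodup_map D.nodup he hf (Prod.ext h h')

theorem eq_or_eq_mate {e f : Endpoint} (he : e ∈ D.ends) (hf : f ∈ D.ends)
    (h : e.chord = f.chord) : e = f ∨ e = f.mate := by
  by_cases h' : e.isOver = f.isOver
  · exact Or.inl (eq_of_chord_eq he hf h h')
  · refine Or.inr (eq_of_chord_eq he (mate_mem_ends hf) h ?_)
    cases h1 : e.isOver <;> cases h2 : f.isOver <;> simp_all

theorem _root_.slotOf_of_mem {C : Fin 2 → List Endpoint} (h : ∀ e ∈ C 0, e ∉ C 1) {e : Endpoint}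
    {i : Fin 2} (he : e ∈ C i) : slotOf C e = (i, (((C i).idxOf e : ℕ) : ZMod 2)) := by
  match i, he with
  | 0, he => exact if_pos he
  | 1, he => exact if_neg fun h' => h e h' he

theorem slot_of_mem {e : Endpoint} {i : Fin 2} (h : e ∈ D.circle i) :
    D.slot e = (i, (((D.circle i).idxOf e : ℕ) : ZMod 2)) :=
  slotOf_of_mem (fun _ h₀ h₁ => absurd (circle_unique h₀ h₁) (by decide)) h

theorem mem_circle_iff {e : Endpoint} (h : e ∈ D.ends) {i : Fin 2} :
    e ∈ D.circle i ↔ (D.slot e).1 = i := by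
  obtain ⟨j, hj⟩ := mem_ends.1 h
  rw [slot_of_mem hj]
  exact ⟨fun hi => circle_unique hj hi, fun hi => hi ▸ hj⟩

theorem slot_eq_slot {D' : GaussDiagram} {e e' : Endpoint} {i : Fin 2} (h : e ∈ D.circle i)
    (h' : e' ∈ D'.circle i)
    (hp : ((D'.circle i).idxOf e' : ZMod 2) = ((D.circle i).idxOf e : ℕ)) :
    D'.slot e' = D.slot e := by
  rw [slot_of_mem h, slot_of_mem h', hp]

theorem ends_eq_union (D : GaussDiagram) :
    D.ends = D.overs ∪ D.overs.image Endpoint.mate := by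
  ext e
  simp only [Finset.mem_union, Finset.mem_image, mem_overs]
  constructor
  · intro h
    cases he : e.isOver
    · exact Or.inr ⟨e.mate, ⟨mate_mem_ends h, by simp [he]⟩, by simp⟩
    · exact Or.inl ⟨h, rfl⟩
  · rintro (⟨h, -⟩ | ⟨f, ⟨h, -⟩, rfl⟩)
    · exact h
    · exact mate_mem_ends h

/-- A sum over all endpoints, chord by chord. -/
theorem sum_ends {M : Type*} [AddCommMonoid M] (D : GaussDiagram) (f : Endpoint → M) :
    ∑ e ∈ D.ends, f e = ∑ e ∈ D.overs, (f e + f e.mate) := by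
  rw [ends_eq_union, Finset.sum_union, Finset.sum_image, Finset.sum_add_distrib]
  · exact fun _ _ _ _ h => Endpoint.mate_injective h
  · rw [Finset.disjoint_left]
    rintro e he hm
    obtain ⟨f, hf, rfl⟩ := Finset.mem_image.1 hm
    have h1 := (mem_overs.1 he).2
    have h2 := (mem_overs.1 hf).2
    simp [h2] at h1

theorem sum_type {M : Type*} [AddCommMonoid M] (D : GaussDiagram) (f : Arrow → M) :
    (D.type.map f).sum = ∑ e ∈ D.overs, f (D.arrow e) := by
  rw [type, Multiset.map_map]
  rfl

/-- The type grows by the arrows of the new chords when the slots of the old endpoints persist. -/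
theorem type_of_insert {D' : GaussDiagram} (N : Finset Endpoint) (hN : Disjoint D.overs N)
    (h : D'.overs = D.overs ∪ N) (hs : ∀ e ∈ D.ends, D'.slot e = D.slot e) :
    D'.type = D.type + N.val.map D'.arrow := by
  rw [type, h, ← Finset.disjUnion_eq_union _ _ hN, Finset.disjUnion_val, Multiset.map_add]
  congr 1
  refine Multiset.map_congr rfl fun e he => ?_
  have he' := (mem_overs.1 he).1
  simp only [arrow, hs e he', hs _ (mate_mem_ends he')]

theorem type_congr {D' : GaussDiagram} (h : D'.ends = D.ends)
    (hs : ∀ e ∈ D.ends, D'.slot e = D.slot e) : D'.type = D.type := by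
  have := type_of_insert (D := D) (D' := D') ∅ (by simp) (by simp [overs, h]) hs
  simpa using this

/-! ### Diagrams of the same type -/

/-- A diagram with the same endpoints on each circle in a different order. -/
def rearrange (D : GaussDiagram) (C : Fin 2 → List Endpoint)
    (h : ∀ i, (D.circle i).Perm (C i)) : GaussDiagram where
  circle := C
  nodup := ((((h 0).append (h 1)).map _).nodup_iff).1 D.nodup
  mate_mem e he :=
    (((h 0).append (h 1)).mem_iff).1 (D.mate_mem e ((((h 0).append (h 1)).mem_iff).2 he))

@[ext] theorem ext_circle {D D' : GaussDiagram} (h : D.circle = D'.circle) : D = D' := by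
  cases D; cases D'; cases h; rfl

/-- Gauss diagrams up to Reidemeister moves and Ξ-moves. -/
def Equivalent : GaussDiagram → GaussDiagram → Prop :=
  Relation.EqvGen fun D D' => D.Reidemeister D' ∨ D.Xi D'

theorem Equivalent.refl (D : GaussDiagram) : D.Equivalent D := Relation.EqvGen.refl _

theorem Equivalent.symm {D D' : GaussDiagram} (h : D.Equivalent D') : D'.Equivalent D :=
  Relation.EqvGen.symm _ _ h

theorem Equivalent.trans {D D' D'' : GaussDiagram} (h : D.Equivalent D')
    (h' : D'.Equivalent D'') : D.Equivalent D'' := Relation.EqvGen.trans _ _ _ h h'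

theorem Xi.swapOuter {D D' : GaussDiagram} (h : D.Xi D') :
    ∃ i, (D.circle i).SwapOuter (D'.circle i) ∧ ∀ j, j ≠ i → D'.circle j = D.circle j := by
  obtain ⟨i, l, r, p₁, p₂, p₃, h₁, h₂⟩ := h
  refine ⟨i, ⟨l, r, p₁, p₂, p₃, h₁, by simp [h₂]⟩, fun j hj => by simp [h₂, hj]⟩

theorem Xi.of_swapOuter {D D' : GaussDiagram} (i : Fin 2)
    (h : (D.circle i).SwapOuter (D'.circle i)) (h' : ∀ j, j ≠ i → D'.circle j = D.circle j) :
    D.Xi D' := by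
  obtain ⟨l, r, p₁, p₂, p₃, h₁, h₂⟩ := h
  refine ⟨i, l, r, p₁, p₂, p₃, h₁, ?_⟩
  funext j
  by_cases hj : j = i
  · subst hj; simp [h₂]
  · simp [hj, h' j hj]

theorem Xi.symm {D D' : GaussDiagram} (h : D.Xi D') : D'.Xi D := by
  obtain ⟨i, h₁, h₂⟩ := h.swapOuter
  exact Xi.of_swapOuter i h₁.symm fun j hj => (h₂ j hj).symm

theorem Xi.perm {D D' : GaussDiagram} (h : D.Xi D') (i : Fin 2) :
    (D.circle i).Perm (D'.circle i) := by
  obtain ⟨j, h₁, h₂⟩ := h.swapOuter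
  by_cases hi : i = j
  · subst hi; exact h₁.perm
  · rw [h₂ i hi]

/-- Exchanges on one circle are realized by Ξ-moves. -/
theorem equivalent_of_swapOuter (i : Fin 2) {l : List Endpoint}
    (h : Relation.ReflTransGen List.SwapOuter (D.circle i) l) :
    ∃ D' : GaussDiagram, D.Equivalent D' ∧ D'.circle = Function.update D.circle i l := by
  induction h with
  | refl => exact ⟨D, .refl _, by simp⟩
  | @tail b c _ hs ih =>
    obtain ⟨D₁, h₁, h₂⟩ := ih
    have hp : ∀ j, (D₁.circle j).Perm (Function.update D₁.circle i c j) := by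
      intro j
      by_cases hj : j = i
      · subst hj; simpa [h₂] using hs.perm
      · simp [hj]
    refine ⟨D₁.rearrange _ hp, h₁.trans (.rel _ _ (Or.inr ?_)), by simp [rearrange, h₂]⟩
    refine Xi.of_swapOuter i ?_ fun j hj => by simp [rearrange, hj]
    simpa [rearrange, h₂] using hs

/-- Diagrams with the same endpoints in the same slots are equivalent. -/
theorem equivalent_of_slot_eq {D' : GaussDiagram} (h : D'.ends = D.ends)
    (hs : ∀ e ∈ D.ends, D'.slot e = D.slot e) : D.Equivalent D' := by
  have hmem : ∀ i e, e ∈ D.circle i ↔ e ∈ D'.circle i := by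
    intro i e
    constructor
    · intro he
      have h1 := mem_ends_of_mem he
      rw [mem_circle_iff (h ▸ h1), hs e h1]
      exact (mem_circle_iff h1).1 he
    · intro he
      have h1 : e ∈ D.ends := h ▸ mem_ends_of_mem he
      rw [mem_circle_iff h1, ← hs e h1]
      exact (mem_circle_iff (h ▸ h1)).1 he
  have key : ∀ i, Relation.ReflTransGen List.SwapOuter (D.circle i) (D'.circle i) := by
    intro i
    refine List.swapOuter_of_parity (D.circle_nodup i)
      ((List.perm_ext_iff_of_nodup (D.circle_nodup i) (D'.circle_nodup i)).2 (hmem i)) ?_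
    intro x hx
    have := hs x (mem_ends_of_mem hx)
    rw [slot_of_mem hx, slot_of_mem ((hmem i x).1 hx)] at this
    exact congrArg Prod.snd this
  obtain ⟨D₁, h₁, h₁'⟩ := equivalent_of_swapOuter 0 (key 0)
  have key1 : Relation.ReflTransGen List.SwapOuter (D₁.circle 1) (D'.circle 1) := by
    rw [h₁']; simpa using key 1
  obtain ⟨D₂, h₂, h₂'⟩ := equivalent_of_swapOuter 1 key1
  have : D₂ = D' := by
    ext1
    rw [h₂', h₁']
    funext i
    fin_cases i <;> simp
  exact this ▸ h₁.trans h₂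

/-- The diagram with renamed chords. -/
def renameChords (f : Equiv.Perm ℕ) (D : GaussDiagram) : GaussDiagram where
  circle i := (D.circle i).map (Endpoint.rename f)
  nodup := by
    rw [← List.map_append, List.map_map]
    have : ((fun e : Endpoint => (e.chord, e.isOver)) ∘ Endpoint.rename f)
        = Prod.map f id ∘ fun e : Endpoint => (e.chord, e.isOver) := rfl
    rw [this, ← List.map_map]
    exact D.nodup.map (Function.Injective.prodMap f.injective Function.injective_id)
  mate_mem e he := by
    rw [← List.map_append] at he ⊢
    obtain ⟨e', h, rfl⟩ := List.mem_map.1 he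
    exact List.mem_map.2 ⟨e'.mate, D.mate_mem _ h, rfl⟩

theorem _root_.Endpoint.rename_injective (f : Equiv.Perm ℕ) :
    Function.Injective (Endpoint.rename f) := by
  intro a b h
  simp only [Endpoint.rename, Endpoint.mk.injEq] at h
  exact Endpoint.ext' (f.injective h.1) h.2.1 h.2.2

theorem _root_.List.idxOf_map_injective {α β : Type*} [DecidableEq α] [DecidableEq β] {f : α → β}
    (hf : Function.Injective f) (l : List α) (x : α) : (l.map f).idxOf (f x) = l.idxOf x := by
  induction l with
  | nil => rfl
  | cons a l ih =>
    rw [List.map_cons, List.idxOf_cons, List.idxOf_cons, ih]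
    simp [Bool.cond_eq_ite, hf.eq_iff]

theorem ends_renameChords (f : Equiv.Perm ℕ) (D : GaussDiagram) :
    (D.renameChords f).ends = D.ends.image (Endpoint.rename f) := by
  ext e
  simp only [mem_ends, renameChords, List.mem_map, Finset.mem_image]
  grind

theorem slot_renameChords (f : Equiv.Perm ℕ) {e : Endpoint} (he : e ∈ D.ends) :
    (D.renameChords f).slot (e.rename f) = D.slot e := by
  obtain ⟨i, hi⟩ := mem_ends.1 he
  refine slot_eq_slot hi (List.mem_map_of_mem hi) ?_
  rw [renameChords, List.idxOf_map_injective (Endpoint.rename_injective f)]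

theorem iso_renameChords (f : Equiv.Perm ℕ) (D : GaussDiagram) : D.Iso (D.renameChords f) :=
  ⟨f, fun _ => List.IsRotated.refl _⟩

/-- The type is a complete invariant of diagrams up to renaming of chords and Ξ-moves that keep
the base points. -/
theorem equivalent_of_type_eq {D' : GaussDiagram} (h : D.type = D'.type) : D.Equivalent D' := by
  obtain ⟨l, hl⟩ := Quot.exists_rep D.overs.val
  obtain ⟨l', hl'⟩ := Quot.exists_rep D'.overs.val
  change (l : Multiset Endpoint) = _ at hl
  change (l' : Multiset Endpoint) = _ at hl'
  have hp : (l.map D.arrow).Perm (l'.map D'.arrow) := by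
    rw [← Multiset.coe_eq_coe, ← Multiset.map_coe, ← Multiset.map_coe, hl, hl']
    exact h
  obtain ⟨m, hmm, hm⟩ : ∃ m : List Endpoint, l.map D.arrow = m.map D'.arrow ∧ m.Perm l' := by
    have := List.eq_map_comp_perm D'.arrow
    exact (congrFun (congrFun this (l.map D.arrow)) l').mpr hp
  have hlmem : ∀ {e}, e ∈ l ↔ e ∈ D.overs := by
    intro e; rw [← Multiset.mem_coe, hl, Finset.mem_val]
  have hmmem : ∀ {e}, e ∈ m ↔ e ∈ D'.overs := by
    intro e; rw [hm.mem_iff, ← Multiset.mem_coe, hl', Finset.mem_val]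
  have hlnd : l.Nodup := by
    rw [← Multiset.coe_nodup, hl]; exact D.overs.nodup
  have hmnd : m.Nodup := by
    rw [hm.nodup_iff, ← Multiset.coe_nodup, hl']; exact D'.overs.nodup
  have hchord : ∀ {E : GaussDiagram} {k : List Endpoint}, k.Nodup → (∀ {e}, e ∈ k ↔ e ∈ E.overs) →
      (k.map Endpoint.chord).Nodup := by
    intro E k hk hmem
    refine (List.nodup_map_iff_inj_on hk).2 fun a ha b hb hab => ?_
    have ha' := mem_overs.1 (hmem.1 ha)
    have hb' := mem_overs.1 (hmem.1 hb)
    exact eq_of_chord_eq ha'.1 hb'.1 hab (ha'.2.trans hb'.2.symm)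
  have hlen : l.length = m.length := by simpa using congrArg List.length hmm
  obtain ⟨f, hf⟩ := List.exists_perm_map_eq (hchord hlnd hlmem) (hchord hmnd hmmem) (by simpa)
  have harr : ∀ (i : ℕ) (h₁ : i < l.length) (h₂ : i < m.length),
      D.arrow l[i] = D'.arrow m[i] := by
    intro i h₁ h₂
    have := List.getElem_of_eq hmm (i := i) (by simpa using h₁)
    simpa using this
  have hml : m = l.map (Endpoint.rename f) := by
    refine List.ext_getElem (by simp [hlen]) fun i h₁ h₂ => ?_
    have h₃ : i < l.length := hlen ▸ h₁
    rw [List.getElem_map]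
    have hc := List.getElem_of_eq hf (i := i) (by simpa using h₃)
    simp only [List.getElem_map] at hc
    have ho := (mem_overs.1 (hlmem.1 (List.getElem_mem h₃))).2
    have ho' := (mem_overs.1 (hmmem.1 (List.getElem_mem h₁))).2
    have hsign := congrArg (fun a : Arrow => a.2.2) (harr i h₃ h₁)
    exact Endpoint.ext' hc.symm (ho'.trans ho.symm) hsign.symm
  have hover : (D.renameChords f).overs = D'.overs := by
    ext e
    rw [← hmmem, hml, mem_overs, ends_renameChords, List.mem_map, Finset.mem_image]
    constructor
    · rintro ⟨⟨a, ha, rfl⟩, h'⟩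
      exact ⟨a, hlmem.2 (mem_overs.2 ⟨ha, h'⟩), rfl⟩
    · rintro ⟨a, ha, rfl⟩
      have := mem_overs.1 (hlmem.1 ha)
      exact ⟨⟨a, this.1, rfl⟩, this.2⟩
  have hends : D'.ends = (D.renameChords f).ends := by
    rw [ends_eq_union, ends_eq_union (D.renameChords f), hover]
  refine (Equivalent.trans (.rel _ _ (Or.inl (Or.inl (iso_renameChords f D)))) ?_)
  refine equivalent_of_slot_eq hends fun e he => ?_
  have key : ∀ e ∈ D'.overs, D'.slot e = (D.renameChords f).slot e ∧
      D'.slot e.mate = (D.renameChords f).slot e.mate := by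
    intro e he
    obtain ⟨i, h₁, rfl⟩ := List.getElem_of_mem (hmmem.2 he)
    have h₃ : i < l.length := hlen ▸ h₁
    have ha := harr i h₃ h₁
    have hi : m[i] = l[i].rename f := by
      simp [hml]
    have hmem := (mem_overs.1 (hlmem.1 (List.getElem_mem h₃))).1
    have s₁ := slot_renameChords f hmem
    have s₂ := slot_renameChords f (mate_mem_ends hmem)
    have hmate : (l[i].rename f).mate = l[i].mate.rename f := rfl
    simp only [arrow, Prod.mk.injEq] at ha
    rw [← ha.1, ← ha.2.1, hi, hmate, s₁, s₂]
    exact ⟨rfl, rfl⟩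
  rw [← hends, ends_eq_union, Finset.mem_union, Finset.mem_image] at he
  rcases he with he | ⟨a, ha, rfl⟩
  · exact (key e he).1
  · exact (key a ha).2

end GaussDiagram

/-! ### Insertion of chords -/

/-- Insertion of two endpoints at the base point of a circle, `e` in the slot `x` and `f` in the
slot of the opposite parity. The slots of the other endpoints persist. -/
def pushPair (C : Fin 2 → List Endpoint) (x : Slot) (e f : Endpoint) : Fin 2 → List Endpoint :=
  Function.update C x.1 (if x.2 = 0 then e :: f :: C x.1 else f :: e :: C x.1)

section pushPair

variable {C : Fin 2 → List Endpoint} {x : Slot} {e f z : Endpoint}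

theorem mem_pushPair {i : Fin 2} :
    z ∈ pushPair C x e f i ↔ (i = x.1 ∧ (z = e ∨ z = f)) ∨ z ∈ C i := by
  unfold pushPair
  by_cases hi : i = x.1
  · subst hi
    split_ifs <;> simp <;> tauto
  · simp [hi]

theorem pushPair_perm (C : Fin 2 → List Endpoint) (x : Slot) (e f : Endpoint) :
    (pushPair C x e f 0 ++ pushPair C x e f 1).Perm (e :: f :: (C 0 ++ C 1)) := by
  have hmid : ∀ a b : Endpoint, (C 0 ++ a :: b :: C 1).Perm (a :: b :: (C 0 ++ C 1)) :=
    fun a b => List.perm_middle.trans (List.perm_middle.cons a)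
  obtain ⟨i, p⟩ := x
  unfold pushPair
  by_cases hp : p = 0 <;> fin_cases i <;> simp only [hp, if_true, if_false] <;> simp
  · exact hmid e f
  · exact List.Perm.swap _ _ _
  · exact (hmid f e).trans (List.Perm.swap _ _ _)

theorem pushPair_filter {p : Endpoint → Bool} (he : p e = false) (hf : p f = false) (i : Fin 2) :
    (pushPair C x e f i).filter p = (C i).filter p := by
  unfold pushPair
  by_cases hi : i = x.1
  · subst hi
    split_ifs <;> simp [he, hf]
  · simp [hi]

theorem pushPair_map (σ : Endpoint → Endpoint) (i : Fin 2) :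
    (pushPair C x e f i).map σ = pushPair (fun i => (C i).map σ) x (σ e) (σ f) i := by
  unfold pushPair
  by_cases hi : i = x.1
  · subst hi
    split_ifs <;> simp_all
  · simp [hi]

theorem ZMod.eq_one_of_ne_zero {p : ZMod 2} (h : p ≠ 0) : p = 1 := by
  revert p; decide

theorem slotOf_pushPair_left (he : e ∉ C 0) (hne : e ≠ f) : slotOf (pushPair C x e f) e = x := by
  obtain ⟨i, p⟩ := x
  unfold slotOf pushPair
  by_cases hp : p = 0
  · subst hp
    fin_cases i <;> simp [he]
  · obtain rfl := ZMod.eq_one_of_ne_zero hp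
    fin_cases i <;> simp [he, hne.symm]

theorem slotOf_pushPair_right (hf : f ∉ C 0) (hne : e ≠ f) :
    slotOf (pushPair C x e f) f = x.bar := by
  obtain ⟨i, p⟩ := x
  unfold slotOf pushPair
  by_cases hp : p = 0
  · subst hp
    fin_cases i <;> simp [hf, hne, Slot.bar]
  · obtain rfl := ZMod.eq_one_of_ne_zero hp
    fin_cases i <;> simp [hf, Slot.bar, ZMod.two_eq_zero, one_add_one_eq_two]

theorem slotOf_pushPair_of_ne (he : z ≠ e) (hf : z ≠ f) :
    slotOf (pushPair C x e f) z = slotOf C z := by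
  have hidx : ∀ (a b : Endpoint) (l : List Endpoint), z ≠ a → z ≠ b →
      ((a :: b :: l).idxOf z : ZMod 2) = l.idxOf z := fun a b l ha hb =>
    (List.idxOf_delete_adjacent (l := []) ha hb).symm
  have h0 : z ∈ pushPair C x e f 0 ↔ z ∈ C 0 := by
    rw [mem_pushPair]; tauto
  have hi : ∀ i, ((pushPair C x e f i).idxOf z : ZMod 2) = (C i).idxOf z := by
    intro i
    unfold pushPair
    by_cases hi : i = x.1
    · subst hi
      rw [Function.update_self]
      split_ifs
      · exact hidx e f _ he hf
      · exact hidx f e _ hf he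
    · simp [hi]
  simp only [slotOf, h0, hi]

theorem pushPair_consec (h : x.2 = 0) : ∃ i l r, pushPair C x e f i = l ++ e :: f :: r :=
  ⟨x.1, [], C x.1, by simp [pushPair, h]⟩

theorem pushPair_consec' (h : x.2 ≠ 0) : ∃ i l r, pushPair C x e f i = l ++ f :: e :: r :=
  ⟨x.1, [], C x.1, by simp [pushPair, h]⟩

theorem consec_pushPair {a b : Endpoint} (h : ∃ i l r, C i = l ++ a :: b :: r) :
    ∃ i l r, pushPair C x e f i = l ++ a :: b :: r := by
  obtain ⟨i, l, r, h⟩ := h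
  unfold pushPair
  by_cases hi : i = x.1
  · subst hi
    split_ifs
    · exact ⟨x.1, e :: f :: l, r, by simp [h]⟩
    · exact ⟨x.1, f :: e :: l, r, by simp [h]⟩
  · exact ⟨i, l, r, by simp [hi, h]⟩

end pushPair

namespace GaussDiagram

variable {D : GaussDiagram}

/-- A diagram with new chords, whose endpoints are listed by `N`, on the circles `C`. -/
def extend (D : GaussDiagram) (C : Fin 2 → List Endpoint) (N : List Endpoint)
    (hp : (C 0 ++ C 1).Perm (N ++ (D.circle 0 ++ D.circle 1)))
    (hN : (N.map fun e => (e.chord, e.isOver)).Nodup) (hm : ∀ e ∈ N, e.mate ∈ N)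
    (hf : ∀ e ∈ N, ∀ f ∈ D.ends, e.chord ≠ f.chord) : GaussDiagram where
  circle := C
  nodup := by
    rw [(hp.map _).nodup_iff, List.map_append]
    refine List.nodup_append.2 ⟨hN, D.nodup, ?_⟩
    intro a ha b hb hab
    obtain ⟨e, he, rfl⟩ := List.mem_map.1 ha
    obtain ⟨f, hf', rfl⟩ := List.mem_map.1 hb
    exact hf e he f (List.mem_toFinset.2 hf') (congrArg Prod.fst hab)
  mate_mem e he := by
    rw [hp.mem_iff, List.mem_append] at he ⊢
    exact he.imp (hm e) (D.mate_mem e)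

section extend

variable {C : Fin 2 → List Endpoint} {N : List Endpoint}
    {hp : (C 0 ++ C 1).Perm (N ++ (D.circle 0 ++ D.circle 1))}
    {hN : (N.map fun e => (e.chord, e.isOver)).Nodup} {hm : ∀ e ∈ N, e.mate ∈ N}
    {hf : ∀ e ∈ N, ∀ f ∈ D.ends, e.chord ≠ f.chord}

theorem type_extend (hs : ∀ e ∈ D.ends, slotOf C e = D.slot e) :
    (D.extend C N hp hN hm hf).type = D.type +
      ((N.filter fun e => e.isOver = true).map (D.extend C N hp hN hm hf).arrow :
        Multiset Arrow) := by
  have hends : ∀ e, e ∈ (D.extend C N hp hN hm hf).ends ↔ e ∈ N ∨ e ∈ D.ends := by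
    intro e
    simp only [ends, List.mem_toFinset]
    exact hp.mem_iff.trans List.mem_append
  have hNd : (N.filter fun e => e.isOver = true).Nodup := (List.Nodup.of_map _ hN).filter _
  rw [type_of_insert (D := D) (D' := D.extend C N hp hN hm hf) (N.filter fun e => e.isOver = true).toFinset _ _ hs]
  · rw [List.toFinset_val, List.dedup_eq_self.2 hNd, Multiset.map_coe]
  · rw [Finset.disjoint_left]
    intro e he he'
    simp only [List.mem_toFinset, List.mem_filter] at he'
    exact hf e he'.1 e (mem_overs.1 he).1 rfl
  · ext e
    simp only [mem_overs, hends, Finset.mem_union, List.mem_toFinset, List.mem_filter,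
      decide_eq_true_eq]
    tauto

end extend

theorem exists_fresh (D : GaussDiagram) : ∃ n, ∀ e ∈ D.ends, e.chord < n := by
  refine ⟨D.ends.sup Endpoint.chord + 1, fun e he => ?_⟩
  exact Nat.lt_succ_of_le (Finset.le_sup (f := Endpoint.chord) he)

/-- A free chord of any sign can be created in any slot. -/
theorem exists_add_free (D : GaussDiagram) (x : Slot) (s : ℤˣ) :
    ∃ D' : GaussDiagram, D.Equivalent D' ∧ D'.type = D.type + {(x, x.bar, s)} := by
  obtain ⟨n, hn⟩ := D.exists_fresh
  set e : Endpoint := ⟨n, true, s⟩ with he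
  have hfresh : ∀ z ∈ D.ends, z ≠ e ∧ z ≠ e.mate := by
    intro z hz
    have := hn z hz
    constructor <;> rintro rfl <;> simp [he] at this
  have hnot : ∀ i, e ∉ D.circle i ∧ e.mate ∉ D.circle i := fun i =>
    ⟨fun h => (hfresh _ (mem_ends_of_mem h)).1 rfl, fun h => (hfresh _ (mem_ends_of_mem h)).2 rfl⟩
  have hne : e ≠ e.mate := e.mate_ne.symm
  let D' := D.extend (pushPair D.circle x e e.mate) [e, e.mate] (pushPair_perm _ _ _ _)
    (by simp [he]) (by simp) (by
      intro a ha f hf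
      have := hn f hf
      simp only [List.mem_cons, List.not_mem_nil, or_false] at ha
      rcases ha with rfl | rfl <;> simp [he] <;> omega)
  refine ⟨D', .rel _ _ (Or.inl (Or.inr (Or.inl ?_))), ?_⟩
  · have hfil : ∀ i, D.circle i = (D'.circle i).filter fun z => z.chord ≠ n := by
      intro i
      change _ = (pushPair D.circle x e e.mate i).filter _
      rw [pushPair_filter (by simp [he]) (by simp [he]), List.filter_eq_self.2]
      intro a ha
      simpa using (hn a (mem_ends_of_mem ha)).ne
    by_cases hx : x.2 = 0
    · exact ⟨e, pushPair_consec hx, hfil⟩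
    · exact ⟨e.mate, by rw [Endpoint.mate_mate]; exact pushPair_consec' hx, hfil⟩
  · rw [type_extend fun z hz => slotOf_pushPair_of_ne (hfresh z hz).1 (hfresh z hz).2]
    have h1 : D'.slot e = x := slotOf_pushPair_left (hnot 0).1 hne
    have h2 : D'.slot e.mate = x.bar := slotOf_pushPair_right (hnot 0).2 hne
    have hfil : ([e, e.mate].filter fun z => z.isOver = true) = [e] := by simp [he]
    rw [hfil]
    change _ + (([D'.arrow e] : List Arrow) : Multiset Arrow) = _
    rw [arrow, h1, h2]
    rfl

/-- Two chords with opposite signs whose endpoints lie in complementary slots can be created. -/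
theorem exists_add_pair (D : GaussDiagram) (x y : Slot) (s : ℤˣ) :
    ∃ D' : GaussDiagram, D.Equivalent D' ∧
      D'.type = D.type + {(x, y, s), (x.bar, y.bar, -s)} := by
  obtain ⟨n, hn⟩ := D.exists_fresh
  set e : Endpoint := ⟨n, true, s⟩ with he
  set f : Endpoint := ⟨n + 1, true, -s⟩ with hf
  have hfresh : ∀ z ∈ D.ends, z ≠ e ∧ z ≠ e.mate ∧ z ≠ f ∧ z ≠ f.mate := by
    intro z hz
    have := hn z hz
    refine ⟨?_, ?_, ?_, ?_⟩ <;> rintro rfl <;> simp [he, hf] at this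
  have hnot : ∀ i, e ∉ D.circle i ∧ e.mate ∉ D.circle i ∧ f ∉ D.circle i ∧ f.mate ∉ D.circle i :=
    fun i => ⟨fun h => (hfresh _ (mem_ends_of_mem h)).1 rfl,
      fun h => (hfresh _ (mem_ends_of_mem h)).2.1 rfl,
      fun h => (hfresh _ (mem_ends_of_mem h)).2.2.1 rfl,
      fun h => (hfresh _ (mem_ends_of_mem h)).2.2.2 rfl⟩
  have h12 : e ≠ f := by simp [he, hf]
  have h13 : e ≠ e.mate := e.mate_ne.symm
  have h14 : e ≠ f.mate := by simp [he, hf, Endpoint.mate]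
  have h23 : f ≠ e.mate := by simp [he, hf, Endpoint.mate]
  have h24 : f ≠ f.mate := f.mate_ne.symm
  have h34 : e.mate ≠ f.mate := by simp [he, hf, Endpoint.mate]
  let D' := D.extend (pushPair (pushPair D.circle x e f) y e.mate f.mate) [e.mate, f.mate, e, f]
    ((pushPair_perm _ _ _ _).trans (((pushPair_perm _ _ _ _).cons _).cons _))
    (by simp [he, hf, Endpoint.mate]) (by simp) (by
      intro a ha b hb
      have := hn b hb
      simp only [List.mem_cons, List.not_mem_nil, or_false] at ha
      rcases ha with rfl | rfl | rfl | rfl <;> simp [he, hf] <;> omega)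
  refine ⟨D', .rel _ _ (Or.inl (Or.inr (Or.inr (Or.inl ?_)))), ?_⟩
  · have hfil : ∀ i, D.circle i =
        (D'.circle i).filter fun z => z.chord ≠ n ∧ z.chord ≠ n + 1 := by
      intro i
      change _ = (pushPair (pushPair D.circle x e f) y e.mate f.mate i).filter _
      rw [pushPair_filter (by simp [he]) (by simp [hf]),
        pushPair_filter (by simp [he]) (by simp [hf]), List.filter_eq_self.2]
      intro a ha
      have := hn a (mem_ends_of_mem ha)
      simp only [decide_eq_true_eq]
      omega
    have hy : (D'.Consec e.mate f.mate ∨ D'.Consec f.mate e.mate) := by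
      by_cases hy : y.2 = 0
      · exact Or.inl (pushPair_consec hy)
      · exact Or.inr (pushPair_consec' hy)
    by_cases hx : x.2 = 0
    · exact ⟨e, f, rfl, rfl, rfl, consec_pushPair (pushPair_consec hx), hy, hfil⟩
    · refine ⟨f, e, rfl, rfl, by simp [he, hf], consec_pushPair (pushPair_consec' hx), hy.symm, ?_⟩
      intro i
      rw [hfil i]
      simp only [he, hf, and_comm]
  · rw [type_extend fun z hz => by
      rw [slotOf_pushPair_of_ne (hfresh z hz).2.1 (hfresh z hz).2.2.2,
        slotOf_pushPair_of_ne (hfresh z hz).1 (hfresh z hz).2.2.1]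
      rfl]
    have s1 : D'.slot e = x :=
      (slotOf_pushPair_of_ne h13 h14).trans (slotOf_pushPair_left (hnot 0).1 h12)
    have s2 : D'.slot f = x.bar :=
      (slotOf_pushPair_of_ne h23 h24).trans (slotOf_pushPair_right (hnot 0).2.2.1 h12)
    have s3 : D'.slot e.mate = y := slotOf_pushPair_left
      (by rw [mem_pushPair]; simp [h13.symm, h23.symm, hnot]) h34
    have s4 : D'.slot f.mate = y.bar := slotOf_pushPair_right
      (by rw [mem_pushPair]; simp [h14.symm, h24.symm, hnot]) h34
    have hfil : ([e.mate, f.mate, e, f].filter fun z => z.isOver = true) = [e, f] := by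
      simp [he, hf]
    rw [hfil]
    change _ + (([D'.arrow e, D'.arrow f] : List Arrow) : Multiset Arrow) = _
    rw [arrow, arrow, s1, s2, s3, s4]
    rfl

/-- The sign given by a parity. -/
def paritySign (p : ZMod 2) : ℤˣ := if p = 0 then 1 else -1

/-- The arrows of three chords in the position required for a third Reidemeister move: `t`, `m` and
`u` are the slots of the endpoints named `a`, `a.mate` and `b.mate` in `GaussDiagram.R3`. -/
def triple (t m u : Slot) : Multiset Arrow :=
  {(t, m, paritySign u.2), (t.bar, u, paritySign m.2), (m.bar, u.bar, paritySign t.2)}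

/-- The arrows of the same three chords after the move. -/
def tripleFlip (t m u : Slot) : Multiset Arrow :=
  {(t.bar, m.bar, paritySign u.2), (t, u.bar, paritySign m.2), (m, u, paritySign t.2)}

/-- Three chords ready for a third Reidemeister move can be inserted, in any slots. -/
theorem exists_triple (D : GaussDiagram) (t m u : Slot) :
    ∃ D' D'' : GaussDiagram, D'.R3 D'' ∧ D'.type = D.type + triple t m u ∧
      D''.type = D.type + tripleFlip t m u := by
  obtain ⟨n, hn⟩ := D.exists_fresh
  set a : Endpoint := ⟨n, true, paritySign u.2⟩ with ha
  set b : Endpoint := ⟨n + 1, true, paritySign m.2⟩ with hb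
  set c : Endpoint := ⟨n + 2, true, paritySign t.2⟩ with hc
  have hfresh : ∀ z ∈ D.ends, z ∉ [a, b, a.mate, c, b.mate, c.mate] := by
    intro z hz hz'
    have := hn z hz
    simp only [List.mem_cons, List.not_mem_nil, or_false] at hz'
    rcases hz' with rfl | rfl | rfl | rfl | rfl | rfl <;> simp [ha, hb, hc] at this
  have hnot : ∀ i, ∀ z ∈ [a, b, a.mate, c, b.mate, c.mate], z ∉ D.circle i :=
    fun i z hz h => hfresh z (mem_ends_of_mem h) hz
  have hnd : [a, b, a.mate, c, b.mate, c.mate].Nodup := by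
    simp [ha, hb, hc, Endpoint.mate]
  simp only [List.nodup_cons, List.mem_cons, List.not_mem_nil, or_false, not_or, not_false_eq_true,
    List.nodup_nil, and_true] at hnd
  obtain ⟨⟨h12, h13, h14, h15, h16⟩, ⟨h23, h24, h25, h26⟩, ⟨h34, h35, h36⟩, ⟨h45, h46⟩, h56⟩ := hnd
  have hchord : ∀ z ∈ [a, b, a.mate, c, b.mate, c.mate], ∀ f ∈ D.ends, z.chord ≠ f.chord := by
    intro z hz f hf
    have := hn f hf
    simp only [List.mem_cons, List.not_mem_nil, or_false] at hz
    rcases hz with rfl | rfl | rfl | rfl | rfl | rfl <;> simp [ha, hb, hc] <;> omega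
  -- The three strands before the move, and with the two endpoints on each strand exchanged.
  let C := pushPair (pushPair (pushPair D.circle t a b) m a.mate c) u b.mate c.mate
  let C' := pushPair (pushPair (pushPair D.circle t b a) m c a.mate) u c.mate b.mate
  let D' := D.extend C [b.mate, c.mate, a.mate, c, a, b]
    ((pushPair_perm _ _ _ _).trans ((((pushPair_perm _ _ _ _).trans
      (((pushPair_perm _ _ _ _).cons _).cons _)).cons _).cons _))
    (by simp [ha, hb, hc, Endpoint.mate]) (by simp) (fun z hz => hchord z (by
      simp only [List.mem_cons, List.not_mem_nil, or_false] at hz ⊢; tauto))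
  let D'' := D.extend C' [c.mate, b.mate, c, a.mate, b, a]
    ((pushPair_perm _ _ _ _).trans ((((pushPair_perm _ _ _ _).trans
      (((pushPair_perm _ _ _ _).cons _).cons _)).cons _).cons _))
    (by simp [ha, hb, hc, Endpoint.mate]) (by simp) (fun z hz => hchord z (by
      simp only [List.mem_cons, List.not_mem_nil, or_false] at hz ⊢; tauto))
  have hfr : ∀ z ∈ D.ends, z ≠ a ∧ z ≠ b ∧ z ≠ a.mate ∧ z ≠ c ∧ z ≠ b.mate ∧ z ≠ c.mate := by
    intro z hz
    simpa only [List.mem_cons, List.not_mem_nil, or_false, not_or] using hfresh z hz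
  refine ⟨D', D'', ?_, ?_, ?_⟩
  · have hord : ∀ (x : Slot) (e f : Endpoint), x.2 = 0 ∧ D'.Consec e f ∨ x.2 ≠ 0 ∧ D'.Consec f e →
        D'.ConsecOrd (paritySign x.2) e f := by
      rintro x e f (⟨h, h'⟩ | ⟨h, h'⟩)
      · exact Or.inl ⟨if_pos h, h'⟩
      · exact Or.inr ⟨if_neg h, h'⟩
    refine ⟨a, b, c, paritySign t.2, paritySign m.2, paritySign u.2, 1, rfl, rfl, rfl,
      by simp [ha, hb], by simp [ha, hc], by simp [hb, hc], hord _ _ _ ?_, hord _ _ _ ?_,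
      hord _ _ _ ?_, by simp [ha], by simp [hb], by simp [hc], ?_⟩
    · by_cases h : t.2 = 0
      · exact Or.inl ⟨h, consec_pushPair (consec_pushPair (pushPair_consec h))⟩
      · exact Or.inr ⟨h, consec_pushPair (consec_pushPair (pushPair_consec' h))⟩
    · by_cases h : m.2 = 0
      · exact Or.inl ⟨h, consec_pushPair (pushPair_consec h)⟩
      · exact Or.inr ⟨h, consec_pushPair (pushPair_consec' h)⟩
    · by_cases h : u.2 = 0
      · exact Or.inl ⟨h, pushPair_consec h⟩
      · exact Or.inr ⟨h, pushPair_consec' h⟩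
    · intro i
      change C' i = (C i).map _
      simp only [C, C', pushPair_map]
      set σ : Endpoint → Endpoint :=
        Equiv.swap a b ∘ Equiv.swap a.mate c ∘ Equiv.swap b.mate c.mate with hσ
      have e1 : σ a = b := by
        simp [hσ, Equiv.swap_apply_of_ne_of_ne h15 h16, Equiv.swap_apply_of_ne_of_ne h13 h14]
      have e2 : σ b = a := by
        simp [hσ, Equiv.swap_apply_of_ne_of_ne h25 h26, Equiv.swap_apply_of_ne_of_ne h23 h24]
      have e3 : σ a.mate = c := by
        simp [hσ, Equiv.swap_apply_of_ne_of_ne h35 h36,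
          Equiv.swap_apply_of_ne_of_ne (Ne.symm h14) (Ne.symm h24)]
      have e4 : σ c = a.mate := by
        simp [hσ, Equiv.swap_apply_of_ne_of_ne h45 h46,
          Equiv.swap_apply_of_ne_of_ne (Ne.symm h13) (Ne.symm h23)]
      have e5 : σ b.mate = c.mate := by
        simp [hσ, Equiv.swap_apply_of_ne_of_ne (Ne.symm h36) (Ne.symm h46),
          Equiv.swap_apply_of_ne_of_ne (Ne.symm h16) (Ne.symm h26)]
      have e6 : σ c.mate = b.mate := by
        simp [hσ, Equiv.swap_apply_of_ne_of_ne (Ne.symm h35) (Ne.symm h45),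
          Equiv.swap_apply_of_ne_of_ne (Ne.symm h15) (Ne.symm h25)]
      have e0 : (fun i => (D.circle i).map σ) = D.circle := by
        funext j
        refine (List.map_congr_left fun z hz => ?_).trans (List.map_id _)
        obtain ⟨g1, g2, g3, g4, g5, g6⟩ := hfr z (mem_ends_of_mem hz)
        simp [hσ, Equiv.swap_apply_of_ne_of_ne g1 g2, Equiv.swap_apply_of_ne_of_ne g3 g4,
          Equiv.swap_apply_of_ne_of_ne g5 g6]
      change _ = pushPair (pushPair (pushPair (fun i => (D.circle i).map σ) t (σ a) (σ b)) m
        (σ a.mate) (σ c)) u (σ b.mate) (σ c.mate) i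
      rw [e0, e1, e2, e3, e4, e5, e6]
  · rw [type_extend fun z hz => by
      obtain ⟨g1, g2, g3, g4, g5, g6⟩ := hfr z hz
      rw [slotOf_pushPair_of_ne g5 g6, slotOf_pushPair_of_ne g3 g4, slotOf_pushPair_of_ne g1 g2]
      rfl]
    have s1 : D'.slot a = t := (slotOf_pushPair_of_ne h15 h16).trans
      ((slotOf_pushPair_of_ne h13 h14).trans (slotOf_pushPair_left (hnot 0 a (by simp)) h12))
    have s2 : D'.slot b = t.bar := (slotOf_pushPair_of_ne h25 h26).trans
      ((slotOf_pushPair_of_ne h23 h24).trans (slotOf_pushPair_right (hnot 0 b (by simp)) h12))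
    have s3 : D'.slot a.mate = m := (slotOf_pushPair_of_ne h35 h36).trans (slotOf_pushPair_left
      (by rw [mem_pushPair]; simp [Ne.symm h13, Ne.symm h23, hnot]) h34)
    have s4 : D'.slot c = m.bar := (slotOf_pushPair_of_ne h45 h46).trans (slotOf_pushPair_right
      (by rw [mem_pushPair]; simp [Ne.symm h14, Ne.symm h24, hnot]) h34)
    have s5 : D'.slot b.mate = u := slotOf_pushPair_left (by
      rw [mem_pushPair, mem_pushPair]
      simp [Ne.symm h15, Ne.symm h25, Ne.symm h35, Ne.symm h45, hnot]) h56
    have s6 : D'.slot c.mate = u.bar := slotOf_pushPair_right (by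
      rw [mem_pushPair, mem_pushPair]
      simp [Ne.symm h16, Ne.symm h26, Ne.symm h36, Ne.symm h46, hnot]) h56
    have hfil : ([b.mate, c.mate, a.mate, c, a, b].filter fun z => z.isOver = true) = [c, a, b] := by
      simp [ha, hb, hc]
    rw [hfil]
    change _ + (([D'.arrow c, D'.arrow a, D'.arrow b] : List Arrow) : Multiset Arrow) = _
    rw [arrow, arrow, arrow, s1, s2, s3, s4, s5, s6]
    congr 1
    exact Multiset.coe_eq_coe.2 ((List.Perm.swap _ _ _).trans ((List.Perm.swap _ _ _).cons _))
  · rw [type_extend fun z hz => by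
      obtain ⟨g1, g2, g3, g4, g5, g6⟩ := hfr z hz
      rw [slotOf_pushPair_of_ne g6 g5, slotOf_pushPair_of_ne g4 g3, slotOf_pushPair_of_ne g2 g1]
      rfl]
    have s1 : D''.slot a = t.bar := (slotOf_pushPair_of_ne h16 h15).trans
      ((slotOf_pushPair_of_ne h14 h13).trans
        (slotOf_pushPair_right (hnot 0 a (by simp)) (Ne.symm h12)))
    have s2 : D''.slot b = t := (slotOf_pushPair_of_ne h26 h25).trans
      ((slotOf_pushPair_of_ne h24 h23).trans
        (slotOf_pushPair_left (hnot 0 b (by simp)) (Ne.symm h12)))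
    have s3 : D''.slot a.mate = m.bar := (slotOf_pushPair_of_ne h36 h35).trans
      (slotOf_pushPair_right
        (by rw [mem_pushPair]; simp [Ne.symm h13, Ne.symm h23, hnot]) (Ne.symm h34))
    have s4 : D''.slot c = m := (slotOf_pushPair_of_ne h46 h45).trans (slotOf_pushPair_left
      (by rw [mem_pushPair]; simp [Ne.symm h14, Ne.symm h24, hnot]) (Ne.symm h34))
    have s5 : D''.slot b.mate = u.bar := slotOf_pushPair_right (by
      rw [mem_pushPair, mem_pushPair]
      simp [Ne.symm h15, Ne.symm h25, Ne.symm h35, Ne.symm h45, hnot]) (Ne.symm h56)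
    have s6 : D''.slot c.mate = u := slotOf_pushPair_left (by
      rw [mem_pushPair, mem_pushPair]
      simp [Ne.symm h16, Ne.symm h26, Ne.symm h36, Ne.symm h46, hnot]) (Ne.symm h56)
    have hfil : ([c.mate, b.mate, c, a.mate, b, a].filter fun z => z.isOver = true) = [c, b, a] := by
      simp [ha, hb, hc]
    rw [hfil]
    change _ + (([D''.arrow c, D''.arrow b, D''.arrow a] : List Arrow) : Multiset Arrow) = _
    rw [arrow, arrow, arrow, s1, s2, s3, s4, s5, s6]
    congr 1
    exact Multiset.coe_eq_coe.2 (List.reverse_perm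
      [(t.bar, m.bar, paritySign u.2), (t, u.bar, paritySign m.2), (m, u, paritySign t.2)])

end GaussDiagram

/-! ### The group of arrows -/

/-- Both arrows between two slots. -/
def bothSigns (x y : Slot) : Multiset Arrow := {(x, y, 1), (x, y, -1)}

theorem bothSigns_eq (x y : Slot) (s : ℤˣ) : bothSigns x y = {(x, y, s), (x, y, -s)} := by
  rcases Int.units_eq_one_or s with rfl | rfl
  · rfl
  · simp only [bothSigns, neg_neg]
    exact Multiset.pair_comm _ _

/-- Multisets of arrows that can be created by Reidemeister moves and Ξ-moves. -/
inductive IsCreatable : Multiset Arrow → Prop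
  | free (x : Slot) (s : ℤˣ) : IsCreatable {(x, x.bar, s)}
  | pair (x y : Slot) (s : ℤˣ) : IsCreatable {(x, y, s), (x.bar, y.bar, -s)}
  | six (t m u : Slot) :
      IsCreatable (bothSigns t m + bothSigns t.bar u + bothSigns m.bar u.bar)

namespace GaussDiagram

theorem paritySign_add_one (p : ZMod 2) : paritySign (p + 1) = -paritySign p := by
  revert p; decide

/-- A third Reidemeister move amounts to the creation of six chords: three pairs are created by
second moves, and the move is applied to one chord of each pair. -/
theorem exists_add_six (D : GaussDiagram) (t m u : Slot) :
    ∃ D' : GaussDiagram, D.Equivalent D' ∧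
      D'.type = D.type + (bothSigns t m + bothSigns t.bar u + bothSigns m.bar u.bar) := by
  obtain ⟨D₁, e₁, h₁⟩ := D.exists_add_pair t m (paritySign u.2)
  obtain ⟨D₂, e₂, h₂⟩ := D₁.exists_add_pair t.bar u (paritySign m.2)
  obtain ⟨D₃, e₃, h₃⟩ := D₂.exists_add_pair m.bar u.bar (paritySign t.2)
  obtain ⟨D₅, -, -, h₅, -⟩ := D.exists_triple t m u
  obtain ⟨D₆, D₇, hR, h₆, h₇⟩ := D₅.exists_triple t.bar m.bar u.bar
  refine ⟨D₇, e₁.trans (e₂.trans (e₃.trans ((equivalent_of_type_eq (D' := D₆) ?_).trans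
    (.rel _ _ (Or.inl (Or.inr (Or.inr (Or.inr hR)))))))), ?_⟩
  · rw [h₃, h₂, h₁, h₆, h₅]
    simp only [triple, Slot.bar_bar, Slot.bar_snd, paritySign_add_one,
      Multiset.insert_eq_cons, ← Multiset.singleton_add]
    abel
  · rw [h₇, h₅, bothSigns_eq t m (paritySign u.2), bothSigns_eq t.bar u (paritySign m.2),
      bothSigns_eq m.bar u.bar (paritySign t.2)]
    simp only [triple, tripleFlip, Slot.bar_bar, Slot.bar_snd, paritySign_add_one,
      Multiset.insert_eq_cons, ← Multiset.singleton_add]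
    abel

theorem exists_add_of_mem_closure {n : Multiset Arrow}
    (hn : n ∈ AddSubmonoid.closure {n | IsCreatable n}) :
    ∀ D : GaussDiagram, ∃ D' : GaussDiagram, D.Equivalent D' ∧ D'.type = D.type + n := by
  induction hn using AddSubmonoid.closure_induction with
  | mem n hn =>
    intro D
    cases hn with
    | free x s => exact D.exists_add_free x s
    | pair x y s => exact D.exists_add_pair x y s
    | six t m u => exact D.exists_add_six t m u
  | zero => exact fun D => ⟨D, .refl _, by simp⟩
  | add a b _ _ iha ihb =>
    intro D
    obtain ⟨D₁, e₁, h₁⟩ := iha D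
    obtain ⟨D₂, e₂, h₂⟩ := ihb D₁
    exact ⟨D₂, e₁.trans e₂, by rw [h₂, h₁, add_assoc]⟩

/-- The circles of the two endpoints of a chord, and the sum of the parities of their positions. -/
abbrev ArrowClass : Type := Fin 2 × Fin 2 × ZMod 2

/-- The class of an arrow. A self-chord is odd if the last entry is `0`; two nonself-chords are
equivalent if the last entries agree. -/
def arrowClass (a : Arrow) : ArrowClass := (a.1.1, a.2.1.1, a.1.2 + a.2.1.2)

/-- The sum of the signs of the arrows of class `k`. -/
def signSum (k : ArrowClass) (m : Multiset Arrow) : ℤ :=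
  (m.map fun a => if arrowClass a = k then (a.2.2 : ℤ) else 0).sum

/-- The contribution of a chord to the number of endpoints in even positions on circle `i` minus
that in odd positions. -/
def imbalance (i : Fin 2) (a : Arrow) : ℤ :=
  (if a.1.1 = i then (paritySign a.1.2 : ℤ) else 0) +
    (if a.2.1.1 = i then (paritySign a.2.1.2 : ℤ) else 0)

/-- The tail of the chosen representative of a class. -/
def repTail (k : ArrowClass) : Slot := (k.1, 0)

/-- The head of the chosen representative of a class. -/
def repHead (k : ArrowClass) : Slot := (k.2.1, k.2.2)

/-- The coordinates of the sum of the two arrows representing a class in terms of the sums for the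
classes `(0, 1, 0)` and `(0, 1, 1)`. -/
def repCoord (k : ArrowClass) : ℤ × ℤ :=
  if k.1 = k.2.1 then (if k.2.2 = 0 then (1, if k.1 = 0 then 1 else -1) else (0, 0))
  else if k.2.2 = 0 then (1, 0) else (0, if k.1 = 0 then 1 else -1)

theorem imbalance_rep : ∀ (i : Fin 2) (k : ArrowClass) (s : ℤˣ),
    imbalance i (repTail k, repHead k, s) =
      (repCoord k).1 + (if i = 0 then 1 else -1) * (repCoord k).2 := by
  decide

section Hom

variable {H : Type*} [AddCommGroup H] {φ : Multiset Arrow →+ H}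

theorem map_bar (hφ : ∀ n, IsCreatable n → φ n = 0) (x y : Slot) (s : ℤˣ) :
    φ {(x.bar, y.bar, -s)} = -φ {(x, y, s)} := by
  have := hφ _ (IsCreatable.pair x y s)
  rw [Multiset.insert_eq_cons, ← Multiset.singleton_add, map_add] at this
  exact eq_neg_of_add_eq_zero_right this

theorem map_bothSigns (x y : Slot) :
    φ (bothSigns x y) = φ {(x, y, 1)} + φ {(x, y, -1)} := by
  rw [← map_add]
  rfl

theorem map_bothSigns_bar (hφ : ∀ n, IsCreatable n → φ n = 0) (x y : Slot) :
    φ (bothSigns x.bar y.bar) = -φ (bothSigns x y) := by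
  have h1 := map_bar hφ x y 1
  have h2 := map_bar hφ x y (-1)
  rw [neg_neg] at h2
  rw [map_bothSigns, map_bothSigns, h1, h2]
  abel

theorem map_bothSigns_rep (hφ : ∀ n, IsCreatable n → φ n = 0) (k : ArrowClass) :
    φ (bothSigns (repTail k) (repHead k)) =
      (repCoord k).1 • φ (bothSigns (0, 0) (1, 0)) + (repCoord k).2 • φ (bothSigns (0, 0) (1, 1)) := by
  have h1 : ∀ x : Slot, φ (bothSigns x x.bar) = 0 := fun x => by
    rw [map_bothSigns, hφ _ (.free x 1), hφ _ (.free x (-1)), add_zero]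
  have h3 : ∀ t m u : Slot, φ (bothSigns t m) + φ (bothSigns t.bar u) =
      φ (bothSigns m u) := fun t m u => by
    have := hφ _ (.six t m u)
    rw [map_add, map_add, map_bothSigns_bar hφ] at this
    exact eq_of_sub_eq_zero ((sub_eq_add_neg _ _).trans this)
  have hb : ∀ x y : Slot, φ (bothSigns x.bar y) = -φ (bothSigns x y.bar) := fun x y => by
    rw [← map_bothSigns_bar hφ, Slot.bar_bar]
  have b1 : φ (bothSigns (0, 1) (1, 0)) = -φ (bothSigns (0, 0) (1, 1)) := hb (0, 0) (1, 0)
  have b2 : φ (bothSigns (0, 1) (1, 1)) = -φ (bothSigns (0, 0) (1, 0)) := hb (0, 0) (1, 1)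
  have b3 : φ (bothSigns (0, 1) (0, 0)) = 0 := h1 (0, 1)
  have b4 : φ (bothSigns (0, 1) (0, 1)) = -φ (bothSigns (0, 0) (0, 0)) := hb (0, 0) (0, 1)
  have c1 : φ (bothSigns (0, 0) (0, 0)) + φ (bothSigns (0, 1) (1, 0)) = φ (bothSigns (0, 0) (1, 0)) :=
    h3 (0, 0) (0, 0) (1, 0)
  have c2 : φ (bothSigns (0, 0) (1, 0)) + φ (bothSigns (0, 1) (0, 0)) = φ (bothSigns (1, 0) (0, 0)) :=
    h3 (0, 0) (1, 0) (0, 0)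
  have c3 : φ (bothSigns (0, 0) (1, 0)) + φ (bothSigns (0, 1) (0, 1)) = φ (bothSigns (1, 0) (0, 1)) :=
    h3 (0, 0) (1, 0) (0, 1)
  have c4 : φ (bothSigns (0, 0) (1, 0)) + φ (bothSigns (0, 1) (1, 0)) = φ (bothSigns (1, 0) (1, 0)) :=
    h3 (0, 0) (1, 0) (1, 0)
  have a0 : φ (bothSigns (0, 0) (0, 0)) =
      φ (bothSigns (0, 0) (1, 0)) + φ (bothSigns (0, 0) (1, 1)) := by
    rw [b1] at c1; rw [← c1]; abel
  have d0 : φ (bothSigns (0, 0) (0, 1)) = 0 := h1 (0, 0)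
  have d1 : φ (bothSigns (1, 0) (1, 1)) = 0 := h1 (1, 0)
  obtain ⟨i, j, c⟩ := k
  by_cases hc : c = 0
  · subst hc
    fin_cases i <;> fin_cases j <;> simp [repTail, repHead, repCoord]
    · exact a0
    · rw [← c2, b3, add_zero]
    · rw [← c4, b1]
  · obtain rfl := ZMod.eq_one_of_ne_zero hc
    fin_cases i <;> fin_cases j <;> simp [repTail, repHead, repCoord]
    · exact d0
    · rw [← c3, b4, a0]; abel
    · exact d1

theorem map_singleton_rep (hφ : ∀ n, IsCreatable n → φ n = 0) (a : Arrow) :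
    ∃ e : ℤ, φ {a} = (a.2.2 : ℤ) • φ {(repTail (arrowClass a), repHead (arrowClass a), 1)} +
        e • φ (bothSigns (repTail (arrowClass a)) (repHead (arrowClass a))) ∧
      ∀ i, imbalance i a =
        ((a.2.2 : ℤ) + 2 * e) *
          imbalance i (repTail (arrowClass a), repHead (arrowClass a), 1) := by
  obtain ⟨⟨i, p⟩, ⟨j, q⟩, s⟩ := a
  have hbar : ∀ r : ZMod 2, (1 + r + 1 : ZMod 2) = r := by decide
  rw [map_bothSigns]
  by_cases hp : p = 0
  · subst hp
    have hk : arrowClass ((i, 0), (j, q), s) = (i, j, q) := by simp [arrowClass]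
    rw [hk]
    simp only [repTail, repHead]
    rcases Int.units_eq_one_or s with rfl | rfl
    · exact ⟨0, by simp, by simp [imbalance]⟩
    · exact ⟨1, by simp, by simp [imbalance]⟩
  · obtain rfl := ZMod.eq_one_of_ne_zero hp
    have hk : arrowClass ((i, 1), (j, q), s) = (i, j, 1 + q) := by simp [arrowClass]
    have h0 := map_bar hφ (i, 0) (j, 1 + q) (-s)
    have e1 : Slot.bar (i, 0) = (i, 1) := rfl
    have e2 : Slot.bar (j, 1 + q) = (j, q) := Prod.ext rfl (hbar q)
    rw [e1, e2, neg_neg] at h0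
    have hsign : ∀ r : ZMod 2, paritySign (1 + r) = - paritySign r := by decide
    have hone : paritySign 1 = -paritySign 0 := by decide
    rw [hk]
    simp only [repTail, repHead]
    have himb : ∀ i', imbalance i' ((i, 1), (j, q), s) =
        - imbalance i' ((i, 0), (j, 1 + q), 1) := by
      intro i'
      simp only [imbalance, hsign, hone]
      split_ifs <;> simp
      ring
    rcases Int.units_eq_one_or s with rfl | rfl
    · refine ⟨-1, ?_, fun i' => ?_⟩
      · rw [h0]; simp
      · rw [himb]; simp
    · refine ⟨0, ?_, fun i' => ?_⟩
      · rw [h0]; simp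
      · rw [himb]; simp

theorem map_eq_sum_rep (hφ : ∀ n, IsCreatable n → φ n = 0) (m : Multiset Arrow) :
    ∃ y z : ℤ, φ m = (∑ k, signSum k m • φ {(repTail k, repHead k, 1)}) +
        (y • φ (bothSigns (0, 0) (1, 0)) + z • φ (bothSigns (0, 0) (1, 1))) ∧
      ∀ i, (m.map (imbalance i)).sum =
        (∑ k, signSum k m * imbalance i (repTail k, repHead k, 1)) +
          2 * (y + (if i = 0 then 1 else -1) * z) := by
  induction m using Multiset.induction_on with
  | empty => exact ⟨0, 0, by simp [signSum], by simp [signSum]⟩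
  | cons a m ih =>
    obtain ⟨y, z, h₁, h₂⟩ := ih
    obtain ⟨e, g₁, g₂⟩ := map_singleton_rep hφ a
    have hs : ∀ k, signSum k (a ::ₘ m) =
        (if arrowClass a = k then (a.2.2 : ℤ) else 0) + signSum k m := by
      intro k; simp [signSum]
    refine ⟨y + e * (repCoord (arrowClass a)).1, z + e * (repCoord (arrowClass a)).2, ?_, ?_⟩
    · rw [← Multiset.singleton_add, map_add, h₁, g₁, map_bothSigns_rep hφ]
      simp only [Multiset.singleton_add, hs, add_smul, ite_smul, zero_smul, Finset.sum_add_distrib,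
        Finset.sum_ite_eq, Finset.mem_univ, if_true, smul_add, mul_smul]
      abel
    · intro i
      rw [Multiset.map_cons, Multiset.sum_cons, h₂, g₂]
      simp only [hs, add_mul, ite_mul (arrowClass a = _), zero_mul, Finset.sum_add_distrib,
        Finset.sum_ite_eq, Finset.mem_univ, if_true]
      rw [imbalance_rep]
      ring

/-- The classes of free chords carry no invariant; all other classes do. -/
def IsEssential (k : ArrowClass) : Prop := k.1 ≠ k.2.1 ∨ k.2.2 = 0

/-- A homomorphism to a group that kills the creatable multisets depends only on the signed counts
of the arrows in the essential classes and on the imbalances of the circles. -/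
theorem map_eq_map (hφ : ∀ n, IsCreatable n → φ n = 0) {m m' : Multiset Arrow}
    (hs : ∀ k, IsEssential k → signSum k m = signSum k m')
    (hi : ∀ i, (m.map (imbalance i)).sum = (m'.map (imbalance i)).sum) : φ m = φ m' := by
  obtain ⟨y, z, h₁, h₂⟩ := map_eq_sum_rep hφ m
  obtain ⟨y', z', h₁', h₂'⟩ := map_eq_sum_rep hφ m'
  have hbar : ∀ k, ¬ IsEssential k → repHead k = (repTail k).bar := by
    rintro ⟨i, j, c⟩ hk
    simp only [IsEssential, ne_eq, not_or, not_not] at hk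
    obtain ⟨rfl, hc⟩ := hk
    obtain rfl := ZMod.eq_one_of_ne_zero hc
    rfl
  have e₁ : (∑ k, signSum k m • φ {(repTail k, repHead k, 1)}) =
      ∑ k, signSum k m' • φ {(repTail k, repHead k, 1)} := by
    refine Finset.sum_congr rfl fun k _ => ?_
    by_cases hk : IsEssential k
    · rw [hs k hk]
    · rw [hbar k hk, hφ _ (.free _ _), smul_zero, smul_zero]
  have e₂ : ∀ i, (∑ k, signSum k m * imbalance i (repTail k, repHead k, 1)) =
      ∑ k, signSum k m' * imbalance i (repTail k, repHead k, 1) := by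
    refine fun i => Finset.sum_congr rfl fun k _ => ?_
    by_cases hk : IsEssential k
    · rw [hs k hk]
    · have : ∀ x : Slot, imbalance i (x, x.bar, 1) = 0 := by revert i; decide
      rw [hbar k hk, this, mul_zero, mul_zero]
  have f₀ := (h₂ 0).symm.trans ((hi 0).trans (h₂' 0))
  have f₁ := (h₂ 1).symm.trans ((hi 1).trans (h₂' 1))
  rw [e₂] at f₀ f₁
  simp only [if_true, one_ne_zero, if_false] at f₀ f₁
  obtain rfl : y = y' := by linarith
  obtain rfl : z = z' := by linarith
  rw [h₁, h₁', e₁]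

end Hom

/-- Multisets of arrows with the same signed counts and imbalances become equal after adding
creatable ones. -/
theorem exists_add_eq_add {m m' : Multiset Arrow}
    (hs : ∀ k, IsEssential k → signSum k m = signSum k m')
    (hi : ∀ i, (m.map (imbalance i)).sum = (m'.map (imbalance i)).sum) :
    ∃ n ∈ AddSubmonoid.closure {n | IsCreatable n},
      ∃ n' ∈ AddSubmonoid.closure {n | IsCreatable n}, m + n = m' + n' := by
  let ι : Multiset Arrow →+ (Arrow → ℤ) :=
    { toFun := fun m a => (m.count a : ℤ)
      map_zero' := by funext a; simp
      map_add' := fun m m' => by funext a; simp }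
  have hι : Function.Injective ι := by
    intro m m' h
    refine Multiset.ext.2 fun a => ?_
    exact Int.ofNat.inj (congrFun h a)
  let N : AddSubgroup (Arrow → ℤ) := AddSubgroup.closure (ι '' {n | IsCreatable n})
  have hq := map_eq_map (φ := (QuotientAddGroup.mk' N).comp ι) (fun n hn =>
    (QuotientAddGroup.eq_zero_iff _).2 (AddSubgroup.subset_closure ⟨n, hn, rfl⟩)) hs hi
  have hmem : -ι m + ι m' ∈ N := QuotientAddGroup.eq.1 hq
  have key : ∀ v ∈ N, ∃ n ∈ AddSubmonoid.closure {n | IsCreatable n},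
      ∃ n' ∈ AddSubmonoid.closure {n | IsCreatable n}, v = ι n - ι n' := by
    intro v hv
    induction hv using AddSubgroup.closure_induction with
    | mem v hv =>
      obtain ⟨n, hn, rfl⟩ := hv
      exact ⟨n, AddSubmonoid.subset_closure hn, 0, zero_mem _, by simp⟩
    | zero => exact ⟨0, zero_mem _, 0, zero_mem _, by simp⟩
    | add v w _ _ hv hw =>
      obtain ⟨a, ha, b, hb, rfl⟩ := hv
      obtain ⟨c, hc, d, hd, rfl⟩ := hw
      exact ⟨a + c, add_mem ha hc, b + d, add_mem hb hd, by rw [map_add, map_add]; abel⟩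
    | neg v _ hv =>
      obtain ⟨a, ha, b, hb, rfl⟩ := hv
      exact ⟨b, hb, a, ha, by abel⟩
  obtain ⟨n, hn, n', hn', h⟩ := key _ hmem
  refine ⟨n, hn, n', hn', hι ?_⟩
  rw [map_add, map_add]
  have : ι n = ι n' + (-ι m + ι m') := by rw [h]; abel
  rw [this]
  abel

/-- Diagrams with the same signed counts and imbalances are equivalent. -/
theorem equivalent_of_signSum_eq {D D' : GaussDiagram}
    (hs : ∀ k, IsEssential k → signSum k D.type = signSum k D'.type)
    (hi : ∀ i, (D.type.map (imbalance i)).sum = (D'.type.map (imbalance i)).sum) :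
    D.Equivalent D' := by
  obtain ⟨n, hn, n', hn', h⟩ := exists_add_eq_add hs hi
  obtain ⟨D₁, e₁, h₁⟩ := exists_add_of_mem_closure hn D
  obtain ⟨D₁', e₁', h₁'⟩ := exists_add_of_mem_closure hn' D'
  exact e₁.trans ((equivalent_of_type_eq (by rw [h₁, h₁', h])).trans e₁'.symm)

end GaussDiagram

/-! ### Invariance under the moves -/

section ListSwap

variable {α : Type*}

theorem List.AdjOrAbsent.map_swap_perm [DecidableEq α] {l : List α} {x y : α} (h : l.AdjOrAbsent x y)
    (hl : l.Nodup) : (l.map (Equiv.swap x y)).Perm l := by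
  refine (List.perm_ext_iff_of_nodup (hl.map (Equiv.injective _)) hl).2 fun z => ?_
  have hxy : x ∈ l ↔ y ∈ l := by
    rcases h with ⟨l₁, l₂, rfl⟩ | ⟨l₁, l₂, rfl⟩ | ⟨h₁, h₂⟩
    · simp
    · simp
    · exact iff_of_false h₁ h₂
  have : z ∈ l.map (Equiv.swap x y) ↔ Equiv.swap x y z ∈ l := by
    rw [List.mem_map]
    constructor
    · rintro ⟨w, hw, rfl⟩
      simpa using hw
    · exact fun hz => ⟨_, hz, by simp⟩
  rw [this]
  by_cases h1 : z = x
  · subst h1; simp [hxy]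
  · by_cases h2 : z = y
    · subst h2; simp [hxy]
    · rw [Equiv.swap_apply_of_ne_of_ne h1 h2]

theorem List.AdjOrAbsent.symm {l : List α} {x y : α} (h : l.AdjOrAbsent x y) :
    l.AdjOrAbsent y x := by
  rcases h with h | h | h
  · exact Or.inr (Or.inl h)
  · exact Or.inl h
  · exact Or.inr (Or.inr h.symm)

theorem List.AdjOrAbsent.idxOf_map_swap [DecidableEq α] {l : List α} {x y : α} (h : l.AdjOrAbsent x y)
    (hl : l.Nodup) {z : α} (hz : z ∈ l) :
    ((l.map (Equiv.swap x y)).idxOf z : ZMod 2) =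
      l.idxOf z + if z = x ∨ z = y then 1 else 0 := by
  rw [List.idxOf_map_equiv, Equiv.symm_swap]
  by_cases h1 : z = x
  · subst h1
    rw [Equiv.swap_apply_left, if_pos (Or.inl rfl), (h.idxOf_succ hl hz).2]
  · by_cases h2 : z = y
    · subst h2
      rw [Equiv.swap_apply_right, if_pos (Or.inr rfl), (h.symm.idxOf_succ hl hz).2]
    · rw [Equiv.swap_apply_of_ne_of_ne h1 h2, if_neg (by tauto), add_zero]

theorem List.AdjOrAbsent.map_equiv {l : List α} {x y : α} (h : l.AdjOrAbsent x y)
    (σ : Equiv.Perm α) (hx : σ x = x) (hy : σ y = y) : (l.map σ).AdjOrAbsent x y := by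
  rcases h with ⟨l₁, l₂, rfl⟩ | ⟨l₁, l₂, rfl⟩ | ⟨h₁, h₂⟩
  · exact Or.inl ⟨l₁.map σ, l₂.map σ, by simp [hx, hy]⟩
  · exact Or.inr (Or.inl ⟨l₁.map σ, l₂.map σ, by simp [hx, hy]⟩)
  · refine Or.inr (Or.inr ⟨fun h => h₁ ?_, fun h => h₂ ?_⟩)
    · obtain ⟨w, hw, hwx⟩ := List.mem_map.1 h
      rwa [← σ.injective (hwx.trans hx.symm)]
    · obtain ⟨w, hw, hwy⟩ := List.mem_map.1 h
      rwa [← σ.injective (hwy.trans hy.symm)]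

end ListSwap

namespace GaussDiagram

variable {D D' : GaussDiagram}

/-- Both circles carry an even number of endpoints. -/
def CirclesEven (D : GaussDiagram) : Prop := ∀ i, ((D.circle i).length : ZMod 2) = 0

theorem signSum_type (k : ArrowClass) (D : GaussDiagram) :
    signSum k D.type = ∑ e ∈ D.overs, if arrowClass (D.arrow e) = k then (e.sign : ℤ) else 0 :=
  sum_type D fun a => if arrowClass a = k then (a.2.2 : ℤ) else 0

theorem Consec.adjOrAbsent {e f : Endpoint} (h : D.Consec e f) (i : Fin 2) :
    (D.circle i).AdjOrAbsent e f := by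
  obtain ⟨j, l, r, h⟩ := h
  have he : e ∈ D.circle j := by simp [h]
  have hf : f ∈ D.circle j := by simp [h]
  by_cases hij : i = j
  · subst hij; exact Or.inl ⟨l, r, h⟩
  · exact Or.inr (Or.inr ⟨fun h => hij (circle_unique h he), fun h => hij (circle_unique h hf)⟩)

theorem ConsecOrd.adjOrAbsent {ε : ℤˣ} {e f : Endpoint} (h : D.ConsecOrd ε e f) (i : Fin 2) :
    (D.circle i).AdjOrAbsent e f := by
  rcases h with ⟨-, h⟩ | ⟨-, h⟩
  · exact h.adjOrAbsent i
  · exact (h.adjOrAbsent i).symm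

theorem Consec.mem_left {e f : Endpoint} (h : D.Consec e f) : e ∈ D.ends := by
  obtain ⟨j, l, r, h⟩ := h
  exact mem_ends_of_mem (i := j) (by simp [h])

theorem Consec.mem_right {e f : Endpoint} (h : D.Consec e f) : f ∈ D.ends := by
  obtain ⟨j, l, r, h⟩ := h
  exact mem_ends_of_mem (i := j) (by simp [h])

theorem slot_of_adjOrAbsent {e f : Endpoint} (h : ∀ i, (D.circle i).AdjOrAbsent e f)
    (he : e ∈ D.ends) : D.slot f = (D.slot e).bar := by
  obtain ⟨i, hi⟩ := mem_ends.1 he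
  obtain ⟨h₁, h₂⟩ := (h i).idxOf_succ (D.circle_nodup i) hi
  rw [slot_of_mem hi, slot_of_mem h₁, h₂]
  rfl

/-- Either both diagrams have an even number of endpoints on each circle or neither has; if they
have, their signed counts in the essential classes agree up to the choice of the base points. -/
def SameInvariants (D D' : GaussDiagram) : Prop :=
  (D.CirclesEven ↔ D'.CirclesEven) ∧ (D.CirclesEven → ∃ κ : ZMod 2, ∀ k, IsEssential k →
    signSum k D'.type = signSum (k.1, k.2.1, if k.1 = k.2.1 then k.2.2 else k.2.2 + κ) D.type)

theorem SameInvariants.refl (D : GaussDiagram) : D.SameInvariants D :=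
  ⟨Iff.rfl, fun _ => ⟨0, fun k _ => by simp⟩⟩

theorem SameInvariants.of_eq (h : ∀ i, ((D'.circle i).length : ZMod 2) = (D.circle i).length)
    (hs : ∀ k, IsEssential k → signSum k D'.type = signSum k D.type) : D.SameInvariants D' :=
  ⟨by simp only [CirclesEven, h], fun _ => ⟨0, fun k hk => by simpa using hs k hk⟩⟩

theorem isEssential_shift {k : ArrowClass} (hk : IsEssential k) (κ : ZMod 2) :
    IsEssential (k.1, k.2.1, if k.1 = k.2.1 then k.2.2 else k.2.2 + κ) := by
  by_cases h : k.1 = k.2.1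
  · simpa [h, IsEssential] using hk
  · exact Or.inl h

theorem SameInvariants.symm (h : D.SameInvariants D') : D'.SameInvariants D := by
  refine ⟨h.1.symm, fun he => ?_⟩
  obtain ⟨κ, hκ⟩ := h.2 (h.1.2 he)
  refine ⟨κ, fun k hk => ?_⟩
  rw [hκ _ (isEssential_shift hk κ)]
  have : κ + κ = 0 := CharTwo.add_self_eq_zero κ
  obtain ⟨i, j, c⟩ := k
  by_cases h : i = j
  · simp [h]
  · simp [h, add_assoc, this]

theorem SameInvariants.trans {D'' : GaussDiagram} (h : D.SameInvariants D')
    (h' : D'.SameInvariants D'') : D.SameInvariants D'' := by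
  refine ⟨h.1.trans h'.1, fun he => ?_⟩
  obtain ⟨κ, hκ⟩ := h.2 he
  obtain ⟨κ', hκ'⟩ := h'.2 (h.1.1 he)
  refine ⟨κ' + κ, fun k hk => ?_⟩
  rw [hκ' k hk, hκ _ (isEssential_shift hk κ')]
  by_cases h : k.1 = k.2.1
  · simp [h]
  · simp [h, add_assoc]

theorem Xi.type_eq (h : D.Xi D') : D'.type = D.type := by
  have hends : D'.ends = D.ends := by
    ext e
    simp only [mem_ends]
    exact exists_congr fun i => ((h.perm i).mem_iff).symm
  refine type_congr hends fun e he => ?_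
  obtain ⟨j, hj⟩ := mem_ends.1 he
  refine slot_eq_slot hj (((h.perm j).mem_iff).1 hj) ?_
  obtain ⟨i, h₁, h₂⟩ := h.swapOuter
  by_cases hij : j = i
  · subst hij; exact h₁.idxOf (D.circle_nodup j) e
  · rw [h₂ j hij]

theorem Xi.sameInvariants (h : D.Xi D') : D.SameInvariants D' :=
  .of_eq (fun i => by rw [(h.perm i).length_eq]) fun k _ => by rw [h.type_eq]

/-- The class of a free chord is not essential. -/
theorem R1.sameInvariants (h : D.R1 D') : D.SameInvariants D' := by
  obtain ⟨e, hc, hf⟩ := h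
  have he := hc.mem_left
  have hf' : ∀ i, D.circle i = (D'.circle i).filter fun x => x ≠ e ∧ x ≠ e.mate := by
    intro i
    rw [hf i]
    refine List.filter_congr fun x hx => ?_
    simp only [decide_eq_decide]
    constructor
    · rintro h
      constructor <;> rintro rfl <;> simp at h
    · rintro ⟨h₁, h₂⟩ h
      exact (eq_or_eq_mate (mem_ends_of_mem hx) he h).elim h₁ h₂
  have hadj := hc.adjOrAbsent
  refine .of_eq (fun i => by rw [hf' i, (hadj i).length_filter (D'.circle_nodup i)]) fun k hk => ?_
  obtain ⟨e₀, he₀, he₁, hover, hslot⟩ : ∃ e₀, e₀ ∈ D'.ends ∧ (∀ z, z = e₀ ∨ z = e₀.mate ↔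
      z = e ∨ z = e.mate) ∧ e₀.isOver = true ∧ D'.slot e₀.mate = (D'.slot e₀).bar := by
    have h1 := slot_of_adjOrAbsent hadj he
    cases ho : e.isOver
    · exact ⟨e.mate, mate_mem_ends he, fun z => by rw [Endpoint.mate_mate, or_comm],
        by simp [ho], by rw [h1, Endpoint.mate_mate, Slot.bar_bar]⟩
    · exact ⟨e, he, fun z => Iff.rfl, ho, h1⟩
  have hmem : ∀ z, z ∈ D.ends ↔ z ∈ D'.ends ∧ ¬ (z = e₀ ∨ z = e₀.mate) := by
    intro z
    rw [he₁]
    simp only [mem_ends, hf', List.mem_filter, decide_eq_true_eq, not_or, exists_and_right]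
  have htype : D'.type = D.type + {D'.arrow e₀} := by
    rw [type_of_insert (D := D) (D' := D') {e₀}]
    · simp
    · simp [mem_overs, hmem]
    · ext z
      simp only [mem_overs, hmem, Finset.mem_union, Finset.mem_singleton]
      constructor
      · rintro ⟨h₁, h₂⟩
        by_cases hz : z = e₀
        · exact Or.inr hz
        · refine Or.inl ⟨⟨h₁, ?_⟩, h₂⟩
          rintro (h | rfl)
          · exact hz h
          · simp [hover] at h₂
      · rintro (⟨⟨h₁, -⟩, h₂⟩ | rfl)
        · exact ⟨h₁, h₂⟩
        · exact ⟨he₀, hover⟩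
    · intro z hz
      obtain ⟨i, hi⟩ := mem_ends.1 hz
      have hi' : z ∈ D'.circle i ∧ z ≠ e ∧ z ≠ e.mate := by
        rw [hf' i] at hi; simpa using hi
      refine slot_eq_slot hi hi'.1 ?_
      rw [hf' i, (hadj i).idxOf_filter (D'.circle_nodup i) hi'.2.1 hi'.2.2]
  have hclass : arrowClass (D'.arrow e₀) ≠ k := by
    rintro rfl
    simp only [IsEssential, arrowClass, arrow, hslot, Slot.bar_fst, Slot.bar_snd] at hk
    rcases hk with hk | hk
    · exact hk rfl
    · revert hk
      generalize (D'.slot e₀).2 = p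
      revert p; decide
  rw [htype]
  simp [signSum, hclass]

/-- The two chords are of the same class and have opposite signs. -/
theorem R2.sameInvariants (h : D.R2 D') : D.SameInvariants D' := by
  obtain ⟨e, f, ho, ho', hsign, hc, hc', hf⟩ := h
  have he := hc.mem_left
  have hfm := hc.mem_right
  have hadj := hc.adjOrAbsent
  have hadj' : ∀ i, (D'.circle i).AdjOrAbsent e.mate f.mate := fun i =>
    hc'.elim (fun h => h.adjOrAbsent i) fun h => (h.adjOrAbsent i).symm
  have hem : ∀ z w : Endpoint, z.isOver = true → w.isOver = true → z ≠ w.mate := by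
    rintro z w hz hw rfl
    simp [hw] at hz
  have hf' : ∀ i, D.circle i = ((D'.circle i).filter fun x => x ≠ e.mate ∧ x ≠ f.mate).filter
      fun x => x ≠ e ∧ x ≠ f := by
    intro i
    rw [hf i, List.filter_filter]
    refine List.filter_congr fun x hx => ?_
    rw [← Bool.decide_and, decide_eq_decide]
    constructor
    · rintro ⟨h₁, h₂⟩
      refine ⟨⟨?_, ?_⟩, ?_, ?_⟩ <;> rintro rfl <;> simp at h₁ h₂
    · rintro ⟨⟨h₁, h₂⟩, h₃, h₄⟩
      exact ⟨fun h => (eq_or_eq_mate (mem_ends_of_mem hx) he h).elim h₁ h₃,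
        fun h => (eq_or_eq_mate (mem_ends_of_mem hx) hfm h).elim h₂ h₄⟩
  have hadj₂ : ∀ i, ((D'.circle i).filter fun x => x ≠ e.mate ∧ x ≠ f.mate).AdjOrAbsent e f :=
    fun i => (hadj i).filter (by simp [hem e e ho ho, hem e f ho ho'])
      (by simp [hem f e ho' ho, hem f f ho' ho'])
  have hnd := fun i => (D'.circle_nodup i).filter fun x => x ≠ e.mate ∧ x ≠ f.mate
  refine .of_eq (fun i => by
    rw [hf' i, (hadj₂ i).length_filter (hnd i), (hadj' i).length_filter (D'.circle_nodup i)])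
    fun k hk => ?_
  have hne : e ≠ f := by
    rintro rfl
    rcases Int.units_eq_one_or e.sign with h | h <;> rw [h] at hsign <;> revert hsign <;> decide
  have hmem : ∀ z, z ∈ D.ends ↔ z ∈ D'.ends ∧ (z ≠ e.mate ∧ z ≠ f.mate) ∧ z ≠ e ∧ z ≠ f := by
    intro z
    simp only [mem_ends, hf', List.mem_filter, decide_eq_true_eq, and_assoc, exists_and_right]
  have htype : D'.type = D.type + {D'.arrow e, D'.arrow f} := by
    rw [type_of_insert (D := D) (D' := D') {e, f}]
    · rw [Finset.insert_val_of_notMem (by simpa using hne)]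
      simp
    · simp [mem_overs, hmem]
    · ext z
      simp only [mem_overs, hmem, Finset.mem_union, Finset.mem_insert, Finset.mem_singleton]
      constructor
      · rintro ⟨h₁, h₂⟩
        by_cases hz : z = e ∨ z = f
        · exact Or.inr hz
        · rw [not_or] at hz
          exact Or.inl ⟨⟨h₁, ⟨hem z e h₂ ho, hem z f h₂ ho'⟩, hz⟩, h₂⟩
      · rintro (⟨⟨h₁, -⟩, h₂⟩ | rfl | rfl)
        · exact ⟨h₁, h₂⟩
        · exact ⟨he, ho⟩
        · exact ⟨hfm, ho'⟩
    · intro z hz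
      obtain ⟨i, hi⟩ := mem_ends.1 hz
      have hi' : (z ∈ D'.circle i ∧ z ≠ e.mate ∧ z ≠ f.mate) ∧ z ≠ e ∧ z ≠ f := by
        rw [hf' i] at hi; simpa only [List.mem_filter, decide_eq_true_eq] using hi
      refine slot_eq_slot hi hi'.1.1 ?_
      rw [hf' i, (hadj₂ i).idxOf_filter (hnd i) hi'.2.1 hi'.2.2,
        (hadj' i).idxOf_filter (D'.circle_nodup i) hi'.1.2.1 hi'.1.2.2]
  have hclass : arrowClass (D'.arrow f) = arrowClass (D'.arrow e) := by
    simp only [arrowClass, arrow, slot_of_adjOrAbsent hadj he,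
      slot_of_adjOrAbsent hadj' (mate_mem_ends he), Slot.bar_fst, Slot.bar_snd]
    congr 2
    linear_combination ZMod.two_eq_zero
  rw [htype]
  have hs : ((D'.arrow f).2.2 : ℤ) = -((D'.arrow e).2.2 : ℤ) := by simp [arrow, hsign]
  by_cases hk' : arrowClass (D'.arrow e) = k
  · simp [signSum, hclass, hk', hs]
  · simp [signSum, hclass, hk']

/-- Both endpoints of each of the three chords move by one position, which preserves the class. -/
theorem R3.sameInvariants (h : D.R3 D') : D.SameInvariants D' := by
  obtain ⟨a, b, c, εT, εM, εB, δ, ha, hb, hc, hab, hac, hbc, hT, hM, hB, -, -, -, hD⟩ := h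
  have hne : ∀ {z w : Endpoint}, z.chord ≠ w.chord → z ≠ w := fun h h' => h (h' ▸ rfl)
  have g₁ : ∀ i, (D.circle i).AdjOrAbsent b.mate c.mate := hB.adjOrAbsent
  have swapfix : ∀ {x y z : Endpoint}, z ≠ x → z ≠ y → Equiv.swap x y z = z :=
    fun h h' => Equiv.swap_apply_of_ne_of_ne h h'
  have hou : ∀ {z w : Endpoint}, z.isOver = true → w.isOver = true → z ≠ w.mate := by
    rintro z w hz hw rfl
    simp [hw] at hz
  have g₂ : ∀ i, ((D.circle i).map (Equiv.swap b.mate c.mate)).AdjOrAbsent a.mate c := fun i =>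
    (hM.adjOrAbsent i).map_equiv _ (swapfix (hne hab) (hne hac)) (swapfix (hou hc hb) (hou hc hc))
  have g₃ : ∀ i, (((D.circle i).map (Equiv.swap b.mate c.mate)).map
      (Equiv.swap a.mate c)).AdjOrAbsent a b := fun i =>
    ((hT.adjOrAbsent i).map_equiv _ (swapfix (hou ha hb) (hou ha hc))
      (swapfix (hou hb hb) (hou hb hc))).map_equiv _ (swapfix (hou ha ha) (hne hac))
      (swapfix (hou hb ha) (hne hbc))
  have hD' : ∀ i, D'.circle i = (((D.circle i).map (Equiv.swap b.mate c.mate)).map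
      (Equiv.swap a.mate c)).map (Equiv.swap a b) := by
    intro i
    rw [hD i, List.map_map, List.map_map, Function.comp_assoc]
  have n₁ := fun i => (D.circle_nodup i).map (Equiv.swap b.mate c.mate).injective
  have n₂ := fun i => (n₁ i).map (Equiv.swap a.mate c).injective
  have p₁ := fun i => (g₁ i).map_swap_perm (D.circle_nodup i)
  have p₂ := fun i => (g₂ i).map_swap_perm (n₁ i)
  have p₃ := fun i => (g₃ i).map_swap_perm (n₂ i)
  have hperm : ∀ i, (D'.circle i).Perm (D.circle i) := fun i => by
    rw [hD' i]
    exact (p₃ i).trans ((p₂ i).trans (p₁ i))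
  have hslot : ∀ z ∈ D.ends, D'.slot z = ((D.slot z).1, (D.slot z).2 +
      (if z = b.mate ∨ z = c.mate then 1 else 0) + (if z = a.mate ∨ z = c then 1 else 0) +
      (if z = a ∨ z = b then 1 else 0)) := by
    intro z hz
    obtain ⟨i, hi⟩ := mem_ends.1 hz
    rw [slot_of_mem hi, slot_of_mem ((hperm i).mem_iff.2 hi), hD' i,
      (g₃ i).idxOf_map_swap (n₂ i) ((p₂ i).mem_iff.2 ((p₁ i).mem_iff.2 hi)),
      (g₂ i).idxOf_map_swap (n₁ i) ((p₁ i).mem_iff.2 hi),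
      (g₁ i).idxOf_map_swap (D.circle_nodup i) hi]
  have hends : D'.ends = D.ends := by
    ext e
    simp only [mem_ends]
    exact exists_congr fun i => (hperm i).mem_iff
  refine .of_eq (fun i => by rw [(hperm i).length_eq]) fun k _ => ?_
  rw [signSum_type, signSum_type]
  refine Finset.sum_congr (by rw [overs, overs, hends]) fun e he => ?_
  have he' : e ∈ D.ends ∧ e.isOver = true := by
    rw [← mem_overs]; simpa [overs, hends] using he
  have hclass : arrowClass (D'.arrow e) = arrowClass (D.arrow e) := by
    simp only [arrowClass, arrow, hslot e he'.1, hslot _ (mate_mem_ends he'.1)]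
    have hmm : ∀ {w : Endpoint}, e.mate = w.mate ↔ e = w := Endpoint.mate_injective.eq_iff
    have e1 : ∀ {w : Endpoint}, w.isOver = true → e ≠ w.mate := fun hw => hou he'.2 hw
    have e2 : ∀ {w : Endpoint}, w.isOver = true → e.mate ≠ w := fun hw h =>
      hou hw he'.2 h.symm
    simp only [hmm, e1 ha, e1 hb, e1 hc, e2 ha, e2 hb, e2 hc, false_or, or_false, if_false,
      add_zero]
    congr 2
    have hab' := hne hab
    have hac' := hne hac
    have hbc' := hne hbc
    have h2 : ∀ p q : ZMod 2, p + 1 + (q + 1) = p + q := by decide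
    by_cases h1 : e = a
    · subst h1; simp [hab', hac', h2]
    · by_cases h3 : e = b
      · subst h3; simp [h1, hbc', h2]
      · by_cases h4 : e = c
        · subst h4; simp [h1, h3, h2]
        · simp [h1, h3, h4]
  rw [hclass]

theorem signSum_renameChords (f : Equiv.Perm ℕ) (D : GaussDiagram) (k : ArrowClass) :
    signSum k (D.renameChords f).type = signSum k D.type := by
  rw [signSum_type, signSum_type]
  have hover : (D.renameChords f).overs = D.overs.image (Endpoint.rename f) := by
    rw [overs, ends_renameChords, Finset.filter_image]
    rfl
  rw [hover, Finset.sum_image fun _ _ _ _ h => Endpoint.rename_injective f h]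
  refine Finset.sum_congr rfl fun e he => ?_
  have h := (mem_overs.1 he).1
  have : (D.renameChords f).arrow (e.rename f) = D.arrow e := by
    have hm : (e.rename f).mate = e.mate.rename f := rfl
    rw [arrow, arrow, hm, slot_renameChords f h, slot_renameChords f (mate_mem_ends h)]
    rfl
  rw [this]
  rfl

/-- Shifting the base points shifts the classes of the nonself-chords simultaneously. -/
theorem signSum_rotate (he : D.CirclesEven) (n : Fin 2 → ℕ)
    (h : ∀ i, D'.circle i = (D.circle i).rotate (n i)) (k : ArrowClass) :
    signSum k D'.type = signSum
      (k.1, k.2.1, if k.1 = k.2.1 then k.2.2 else k.2.2 + ((n 0 : ZMod 2) + n 1)) D.type := by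
  have hmem : ∀ i e, e ∈ D'.circle i ↔ e ∈ D.circle i := fun i e => by
    rw [h i, List.mem_rotate]
  have hends : D'.ends = D.ends := by
    ext e
    simp only [mem_ends, hmem]
  have hslot : ∀ z ∈ D.ends, D'.slot z = ((D.slot z).1, (D.slot z).2 + n (D.slot z).1) := by
    intro z hz
    obtain ⟨i, hi⟩ := mem_ends.1 hz
    have heven : Even (D.circle i).length := by
      have := he i
      rwa [ZMod.natCast_eq_zero_iff_even] at this
    rw [slot_of_mem hi, slot_of_mem ((hmem i z).2 hi), h i,
      List.idxOf_rotate_parity (D.circle_nodup i) heven _ hi]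
  rw [signSum_type, signSum_type]
  refine Finset.sum_congr (by rw [overs, overs, hends]) fun e he => ?_
  have he' : e ∈ D.ends := by
    exact (mem_overs.1 he).1
  have key : arrowClass (D'.arrow e) = k ↔ arrowClass (D.arrow e) =
      (k.1, k.2.1, if k.1 = k.2.1 then k.2.2 else k.2.2 + ((n 0 : ZMod 2) + n 1)) := by
    simp only [arrowClass, arrow, hslot e he', hslot _ (mate_mem_ends he')]
    generalize D.slot e = x
    generalize D.slot e.mate = y
    generalize hn : (fun i => (n i : ZMod 2)) = ν
    have hν : ∀ i, (n i : ZMod 2) = ν i := fun i => congrFun hn i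
    obtain ⟨i, j, c⟩ := k
    simp only [hν, Prod.mk.injEq]
    refine and_congr_right fun hi => and_congr_right fun hj => ?_
    rw [hi, hj]
    by_cases hij : i = j
    · subst hij
      have hp : ∀ p q r : ZMod 2, p + r + (q + r) = p + q := by decide
      rw [if_pos rfl, hp]
    · have hp : ∀ p q r s d : ZMod 2, p + r + (q + s) = d ↔ p + q = d + (r + s) := by decide
      have hsum : ν i + ν j = ν 0 + ν 1 := by
        fin_cases i <;> fin_cases j
        · exact absurd rfl hij
        · rfl
        · exact add_comm _ _
        · exact absurd rfl hij
      rw [if_neg hij, hp, hsum]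
  by_cases hk : arrowClass (D'.arrow e) = k
  · rw [if_pos hk, if_pos (key.1 hk)]
  · rw [if_neg hk, if_neg fun h => hk (key.2 h)]

theorem Iso.sameInvariants (h : D.Iso D') : D.SameInvariants D' := by
  obtain ⟨f, hf⟩ := h
  choose n hn using hf
  have hlen : ∀ i, (D'.circle i).length = (D.circle i).length := fun i => by
    rw [← hn i]; simp
  refine ⟨by simp only [CirclesEven, hlen], fun he => ⟨(n 0 : ZMod 2) + n 1, fun k _ => ?_⟩⟩
  rw [signSum_rotate (D := D.renameChords f) (fun i => by
    simpa [renameChords] using he i) n (fun i => (hn i).symm), signSum_renameChords]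

theorem Equivalent.sameInvariants (h : D.Equivalent D') : D.SameInvariants D' := by
  induction h with
  | rel _ _ h =>
    rcases h with (h | h | h | h) | h
    · exact h.sameInvariants
    · exact h.sameInvariants
    · exact h.sameInvariants
    · exact h.sameInvariants
    · exact h.sameInvariants
  | refl => exact .refl _
  | symm _ _ _ ih => exact ih.symm
  | trans _ _ _ _ _ ih₁ ih₂ => exact ih₁.trans ih₂

end GaussDiagram

/-! ### The invariants in terms of arrows -/

namespace GaussDiagram

variable {D D' : GaussDiagram}

theorem sum_ends_eq_sum_circles {M : Type*} [AddCommMonoid M] (D : GaussDiagram)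
    (f : Endpoint → M) :
    ∑ e ∈ D.ends, f e = ((D.circle 0).map f).sum + ((D.circle 1).map f).sum := by
  rw [ends, List.sum_toFinset _ D.nodup_append, List.map_append, List.sum_append]

/-- A sum over the endpoints on one circle, chord by chord. -/
theorem sum_circle {M : Type*} [AddCommMonoid M] (D : GaussDiagram) (i : Fin 2)
    (f : Endpoint → M) :
    ((D.circle i).map f).sum = ∑ e ∈ D.overs, ((if (D.slot e).1 = i then f e else 0) +
      (if (D.slot e.mate).1 = i then f e.mate else 0)) := by
  rw [← sum_ends D fun e => if (D.slot e).1 = i then f e else 0, sum_ends_eq_sum_circles]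
  have h : ∀ j, ((D.circle j).map fun e => if (D.slot e).1 = i then f e else 0) =
      (D.circle j).map fun e => if j = i then f e else 0 := fun j =>
    List.map_congr_left fun e he => by rw [slot_of_mem he]
  rw [h, h]
  fin_cases i <;> simp

/-- If a circle carries an even number of endpoints, then half of them are in even positions. -/
theorem sum_imbalance (he : D.CirclesEven) (i : Fin 2) :
    (D.type.map (imbalance i)).sum = 0 := by
  have heven : Even (D.circle i).length := by
    have := he i
    rwa [ZMod.natCast_eq_zero_iff_even] at this
  rw [sum_type, ← List.sum_map_idxOf_neg_one (D.circle_nodup i) heven]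
  have hsign : ∀ n : ℕ, ((paritySign (n : ZMod 2) : ℤˣ) : ℤ) = (-1) ^ n := by
    intro n
    rcases Nat.even_or_odd n with h | h
    · rw [(ZMod.natCast_eq_zero_iff_even).2 h, h.neg_one_pow]; rfl
    · rw [(ZMod.natCast_eq_one_iff_odd).2 h, h.neg_one_pow]; rfl
  have hmap : ((D.circle i).map fun x => (-1 : ℤ) ^ (D.circle i).idxOf x) =
      (D.circle i).map fun x => (paritySign (D.slot x).2 : ℤ) :=
    List.map_congr_left fun e he => by rw [slot_of_mem he, hsign]
  rw [hmap, sum_circle]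
  rfl

theorem mem_chords {e : Endpoint} {i j : Fin 2} :
    e ∈ D.chords i j ↔ e ∈ D.overs ∧ (D.slot e).1 = i ∧ (D.slot e.mate).1 = j := by
  simp only [chords, List.mem_filter, decide_eq_true_eq, mem_overs]
  constructor
  · rintro ⟨h₁, h₂, h₃⟩
    exact ⟨⟨mem_ends_of_mem h₁, h₂⟩, (mem_circle_iff (mem_ends_of_mem h₁)).1 h₁,
      (mem_circle_iff (mem_ends_of_mem h₃)).1 h₃⟩
  · rintro ⟨⟨h₁, h₂⟩, h₃, h₄⟩
    exact ⟨(mem_circle_iff h₁).2 h₃, h₂, (mem_circle_iff (mate_mem_ends h₁)).2 h₄⟩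

theorem nodup_chords (D : GaussDiagram) (i j : Fin 2) : (D.chords i j).Nodup :=
  (D.circle_nodup i).filter _

theorem length_chords (D : GaussDiagram) (i j : Fin 2) :
    ((D.chords i j).length : ZMod 2) =
      ∑ e ∈ D.overs, if (D.slot e).1 = i ∧ (D.slot e.mate).1 = j then 1 else 0 := by
  rw [← List.toFinset_card_of_nodup (D.nodup_chords i j), Finset.sum_boole]
  congr 2
  ext e
  simp [mem_chords]

/-- Modulo two, the endpoints on a circle are counted by the nonself-chords, since a self-chord has
two endpoints on its circle or none. -/
theorem IsEven.circlesEven (h : D.IsEven) : D.CirclesEven := by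
  intro i
  have h₁ : (D.nonself.length : ZMod 2) = 0 := (ZMod.natCast_eq_zero_iff_even).2 h
  have h₂ : (((D.circle i).length : ℕ) : ZMod 2) = ((D.circle i).map fun _ => (1 : ZMod 2)).sum := by
    simp
  clear h
  refine Eq.trans ?_ h₁
  rw [h₂, sum_circle, nonself, List.length_append, Nat.cast_add, length_chords,
    length_chords, ← Finset.sum_add_distrib]
  clear h₁ h₂
  refine Finset.sum_congr rfl fun e _ => ?_
  generalize (D.slot e).1 = a
  generalize (D.slot e.mate).1 = b
  revert i a b
  decide

/-- The sum of the parities of the positions of the two endpoints of a chord. Nonself-chords are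
equivalent if and only if they have the same colour. -/
def colour (D : GaussDiagram) (e : Endpoint) : ZMod 2 := (D.slot e).2 + (D.slot e.mate).2

theorem sum_sign_filter_chords {i j : Fin 2} {c : ZMod 2} (p : Endpoint → Prop) [DecidablePred p]
    (h : ∀ e ∈ D.chords i j, p e ↔ D.colour e = c) :
    (((D.chords i j).filter fun e => p e).map fun e => (e.sign : ℤ)).sum =
      signSum (i, j, c) D.type := by
  rw [signSum_type, ← Finset.sum_filter, ← List.sum_toFinset _ ((D.nodup_chords i j).filter _)]
  refine Finset.sum_congr ?_ fun _ _ => rfl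
  ext e
  simp only [List.mem_toFinset, List.mem_filter, decide_eq_true_eq, Finset.mem_filter]
  constructor
  · rintro ⟨h₁, h₂⟩
    obtain ⟨h₃, h₄, h₅⟩ := mem_chords.1 h₁
    exact ⟨h₃, Prod.ext h₄ (Prod.ext h₅ ((h e h₁).1 h₂))⟩
  · rintro ⟨h₁, h₂⟩
    simp only [arrowClass, arrow, Prod.mk.injEq] at h₂
    have h₃ := mem_chords.2 ⟨h₁, h₂.1, h₂.2.1⟩
    exact ⟨h₃, (h e h₃).2 h₂.2.2⟩

theorem idxOf_ne {e f : Endpoint} {i : Fin 2} (he : e ∈ D.circle i) (hne : e ≠ f) :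
    (D.circle i).idxOf e ≠ (D.circle i).idxOf f := fun h => hne ((List.idxOf_inj he).1 h)

theorem oddWrithe_eq (D : GaussDiagram) (i : Fin 2) :
    D.oddWrithe i = signSum (i, i, 0) D.type := by
  refine sum_sign_filter_chords _ fun e he => ?_
  obtain ⟨h₁, h₂, h₃⟩ := mem_chords.1 he
  have h₁' := (mem_overs.1 h₁).1
  have m₁ := (mem_circle_iff h₁').2 h₂
  have m₂ := (mem_circle_iff (mate_mem_ends h₁')).2 h₃
  have hne := idxOf_ne m₁ e.mate_ne.symm
  rw [colour, slot_of_mem m₁, slot_of_mem m₂, arc]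
  dsimp only
  rw [← Nat.cast_add, ZMod.natCast_eq_zero_iff_even]
  generalize (D.circle i).idxOf e = p at *
  generalize (D.circle i).idxOf e.mate = q at *
  grind

theorem mem_nonself {e : Endpoint} :
    e ∈ D.nonself ↔ e ∈ D.overs ∧ (D.slot e).1 ≠ (D.slot e.mate).1 := by
  rw [nonself, List.mem_append, mem_chords, mem_chords]
  generalize (D.slot e).1 = a
  generalize (D.slot e.mate).1 = b
  rw [← and_or_left]
  refine and_congr_right fun _ => ?_
  revert a b
  decide

theorem foot_spec {e : Endpoint} (he : e ∈ D.nonself) :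
    (D.foot 0 e ∈ D.circle 0 ∧ D.foot 1 e ∈ D.circle 1) ∧
      (∀ i, (D.foot i e).chord = e.chord) ∧
      D.colour e = ((D.circle 0).idxOf (D.foot 0 e) : ℕ) + ((D.circle 1).idxOf (D.foot 1 e) : ℕ) := by
  obtain ⟨h₁, h₂⟩ := mem_nonself.1 he
  have h := (mem_overs.1 h₁).1
  have hchord : ∀ i, (D.foot i e).chord = e.chord := fun i => by
    unfold foot; split_ifs <;> rfl
  have h01 : ∀ a b : Fin 2, a ≠ b → (a = 0 ∧ b = 1) ∨ (a = 1 ∧ b = 0) := by decide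
  have hnot : ∀ {z : Endpoint} {i j : Fin 2}, z ∈ D.circle i → i ≠ j → z ∉ D.circle j :=
    fun hz hij hz' => hij (circle_unique hz hz')
  rcases h01 _ _ h₂ with ⟨ha, hb⟩ | ⟨ha, hb⟩
  · have m₁ := (mem_circle_iff h).2 ha
    have m₂ := (mem_circle_iff (mate_mem_ends h)).2 hb
    have f₀ : D.foot 0 e = e := if_pos m₁
    have f₁ : D.foot 1 e = e.mate := if_neg (hnot m₁ (by decide))
    refine ⟨⟨by rwa [f₀], by rwa [f₁]⟩, hchord, ?_⟩
    rw [f₀, f₁, colour, slot_of_mem m₁, slot_of_mem m₂]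
  · have m₁ := (mem_circle_iff h).2 ha
    have m₂ := (mem_circle_iff (mate_mem_ends h)).2 hb
    have f₀ : D.foot 0 e = e.mate := if_neg (hnot m₁ (by decide))
    have f₁ : D.foot 1 e = e := if_pos m₁
    refine ⟨⟨by rwa [f₀], by rwa [f₁]⟩, hchord, ?_⟩
    rw [f₀, f₁, colour, slot_of_mem m₁, slot_of_mem m₂, add_comm]

theorem chordEquiv_iff {e γ : Endpoint} (he : e ∈ D.nonself) (hγ : γ ∈ D.nonself) :
    D.ChordEquiv e γ ↔ D.colour e = D.colour γ := by
  by_cases hne : e = γ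
  · subst hne
    simp [ChordEquiv, arc]
  obtain ⟨⟨a₀, a₁⟩, ha, hc⟩ := foot_spec he
  obtain ⟨-, hb, hc'⟩ := foot_spec hγ
  have hov := mem_overs.1 (mem_nonself.1 he).1
  have hov' := mem_overs.1 (mem_nonself.1 hγ).1
  have hfoot : ∀ i, D.foot i e ≠ D.foot i γ := fun i h => hne
    (eq_of_chord_eq hov.1 hov'.1 ((ha i).symm.trans ((congrArg _ h).trans (hb i)))
      (hov.2.trans hov'.2.symm))
  have n₀ := idxOf_ne a₀ (hfoot 0)
  have n₁ := idxOf_ne a₁ (hfoot 1)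
  rw [hc, hc', ← Nat.cast_add, ← Nat.cast_add, ← CharTwo.add_eq_zero, ← Nat.cast_add,
    ZMod.natCast_eq_zero_iff_even, ChordEquiv, arc, arc]
  generalize (D.circle 0).idxOf (D.foot 0 e) = p at *
  generalize (D.circle 0).idxOf (D.foot 0 γ) = q at *
  generalize (D.circle 1).idxOf (D.foot 1 e) = r at *
  generalize (D.circle 1).idxOf (D.foot 1 γ) = s at *
  grind

theorem mem_nonself_of_mem_chords {e : Endpoint} {i j : Fin 2} (hij : i ≠ j)
    (he : e ∈ D.chords i j) : e ∈ D.nonself := by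
  obtain ⟨h₁, h₂, h₃⟩ := mem_chords.1 he
  exact mem_nonself.2 ⟨h₁, by rwa [h₂, h₃]⟩

theorem sigma_eq {γ : Endpoint} (hγ : γ ∈ D.nonself) {i j : Fin 2} (hij : i ≠ j) :
    D.sigma γ i j = signSum (i, j, D.colour γ) D.type :=
  sum_sign_filter_chords _ fun _ he => chordEquiv_iff (mem_nonself_of_mem_chords hij he) hγ

theorem tau_eq {γ : Endpoint} (hγ : γ ∈ D.nonself) {i j : Fin 2} (hij : i ≠ j) :
    D.tau γ i j = signSum (i, j, D.colour γ + 1) D.type := by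
  refine sum_sign_filter_chords _ fun e he => ?_
  rw [chordEquiv_iff (mem_nonself_of_mem_chords hij he) hγ]
  generalize D.colour e = p
  generalize D.colour γ = q
  revert p q
  decide

/-- The linking numbers of `D`, with the chords of colour `c` counted in the first entries. -/
def linkingNumbers (D : GaussDiagram) (c : ZMod 2) : (ℤ × ℤ) × (ℤ × ℤ) :=
  ((signSum (0, 1, c) D.type, signSum (0, 1, c + 1) D.type),
    (signSum (1, 0, c) D.type, signSum (1, 0, c + 1) D.type))

theorem linkingNumbers_add_one (D : GaussDiagram) (c : ZMod 2) :
    D.linkingNumbers (c + 1) = ((D.linkingNumbers c).1.swap, (D.linkingNumbers c).2.swap) := by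
  have : c + 1 + 1 = c := by revert c; decide
  simp [linkingNumbers, this]

theorem mk_linkingNumbers_eq_mk_iff (D D' : GaussDiagram) :
    LinkingClass.mk (D.linkingNumbers 0) = LinkingClass.mk (D'.linkingNumbers 0) ↔
      ∃ κ, D'.linkingNumbers 0 = D.linkingNumbers κ := by
  have h : LinkingClass.mk (D'.linkingNumbers 0) = LinkingClass.mk (D.linkingNumbers 0) ↔
      D'.linkingNumbers 0 = D.linkingNumbers 0 ∨ D'.linkingNumbers 0 = D.linkingNumbers (0 + 1) := by
    rw [linkingNumbers_add_one]
    exact Quotient.eq (r := dotSetoid)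
  have h2 : ∀ p : ZMod 2 → Prop, (∃ κ, p κ) ↔ p 0 ∨ p (0 + 1) := fun p =>
    ⟨fun ⟨κ, hκ⟩ => by
      by_cases h : κ = 0
      · exact Or.inl (h ▸ hκ)
      · obtain rfl := ZMod.eq_one_of_ne_zero h
        exact Or.inr hκ, fun h => h.elim (fun h => ⟨_, h⟩) fun h => ⟨_, h⟩⟩
  rw [eq_comm, h, h2]

theorem IsReducedLinkingClass.eq {F : LinkingClass} (h : D.IsReducedLinkingClass F) :
    F = LinkingClass.mk (D.linkingNumbers 0) := by
  rcases h with ⟨γ, hγ, rfl⟩ | ⟨hn, rfl⟩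
  · rw [sigma_eq hγ (by decide), sigma_eq hγ (by decide), tau_eq hγ (by decide),
      tau_eq hγ (by decide)]
    change LinkingClass.mk (D.linkingNumbers (D.colour γ)) = _
    by_cases hc : D.colour γ = 0
    · rw [hc]
    · rw [ZMod.eq_one_of_ne_zero hc]
      refine Quotient.sound (s := dotSetoid) (Or.inr ?_)
      rw [← linkingNumbers_add_one]
      rfl
  · have h0 : ∀ i j c, i ≠ j → signSum (i, j, c) D.type = 0 := by
      intro i j c hij
      rw [← sum_sign_filter_chords (D := D) (fun e => D.colour e = c) fun _ _ => Iff.rfl]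
      have : D.chords i j = [] := List.eq_nil_iff_forall_not_mem.2 fun e he => by
        have := mem_nonself_of_mem_chords hij he
        simp [hn] at this
      simp [this]
    simp [linkingNumbers, h0]

/-- The diagram with the base point of the first circle moved forward by `n` endpoints. -/
def rotate (D : GaussDiagram) (n : ℕ) : GaussDiagram :=
  D.rearrange (fun i => (D.circle i).rotate (if i = 0 then n else 0))
    fun _ => (List.rotate_perm _ _).symm

theorem iso_rotate (D : GaussDiagram) (n : ℕ) : D.Iso (D.rotate n) := by
  refine ⟨1, fun i => ⟨if i = 0 then n else 0, ?_⟩⟩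
  have : (D.circle i).map (Endpoint.rename 1) = D.circle i := by
    refine (List.map_congr_left fun z _ => ?_).trans (List.map_id _)
    rfl
  rw [this]
  rfl

/-- Even diagrams are equivalent if and only if their odd writhes and their linking numbers, up to
the choice of a colour, agree. -/
theorem equivalent_iff (he : D.CirclesEven) (he' : D'.CirclesEven) :
    D.Equivalent D' ↔ D.oddWrithe 0 = D'.oddWrithe 0 ∧ D.oddWrithe 1 = D'.oddWrithe 1 ∧
      ∃ κ, D'.linkingNumbers 0 = D.linkingNumbers κ := by
  simp only [oddWrithe_eq]
  constructor
  · intro h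
    obtain ⟨κ, hκ⟩ := h.sameInvariants.2 he
    refine ⟨?_, ?_, κ, ?_⟩
    · simpa using (hκ (0, 0, 0) (Or.inr rfl)).symm
    · simpa using (hκ (1, 1, 0) (Or.inr rfl)).symm
    · have hk : ∀ i j c, i ≠ j → signSum (i, j, c) D'.type = signSum (i, j, c + κ) D.type := by
        intro i j c hij
        have := hκ (i, j, c) (Or.inl hij)
        simpa [hij] using this
      simp only [linkingNumbers, hk 0 1 _ (by decide), hk 1 0 _ (by decide), zero_add]
      rw [add_comm 1 κ]
  · rintro ⟨h₀, h₁, κ, hκ⟩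
    -- Moving a base point by one endpoint exchanges the two colours.
    have hrot := (iso_rotate D κ.val).sameInvariants
    refine Equivalent.trans (.rel _ _ (Or.inl (Or.inl (iso_rotate D κ.val))))
      (equivalent_of_signSum_eq (fun k hk => ?_) fun i => ?_)
    · rw [signSum_rotate (D' := D.rotate κ.val) he (fun i => if i = 0 then κ.val else 0)
        (fun i => rfl) k]
      simp only [if_true, one_ne_zero, if_false, Nat.cast_zero, add_zero, ZMod.natCast_val,
        ZMod.cast_id', id_eq]
      simp only [linkingNumbers, Prod.mk.injEq, zero_add] at hκ
      obtain ⟨⟨a₁, a₂⟩, a₃, a₄⟩ := hκ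
      obtain ⟨i, j, c⟩ := k
      have h01 : ∀ c : ZMod 2, c = 0 ∨ c = 1 := by decide
      rw [add_comm κ 1] at a₂ a₄
      fin_cases i <;> fin_cases j
      · obtain rfl : c = 0 := hk.resolve_left fun h => h rfl
        simpa using h₀
      · rcases h01 c with rfl | rfl
        · simpa using a₁.symm
        · simpa using a₂.symm
      · rcases h01 c with rfl | rfl
        · simpa using a₃.symm
        · simpa using a₄.symm
      · obtain rfl : c = 0 := hk.resolve_left fun h => h rfl
        simpa using h₁
    · rw [sum_imbalance (hrot.1.1 he), sum_imbalance he']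

end GaussDiagram

/-! ### Virtual links -/

namespace VirtualLink

open GaussDiagram

theorem XiMove.symm {L L' : VirtualLink} (h : L.XiMove L') : L'.XiMove L := by
  obtain ⟨D, D', h₁, h₂, h₃⟩ := h
  exact ⟨D', D, h₂, h₁, h₃.symm⟩

theorem equivalent_of_represents {D D' : GaussDiagram} {L : VirtualLink} (h : D.Represents L)
    (h' : D'.Represents L) : D.Equivalent D' :=
  Relation.EqvGen.mono (fun _ _ => Or.inl) _ _
    (Quotient.exact (s := reidemeisterSetoid) (h.trans h'.symm))

theorem XiEquiv.equivalent {L L' : VirtualLink} (h : L.XiEquiv L') {D D' : GaussDiagram}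
    (hD : D.Represents L) (hD' : D'.Represents L') : D.Equivalent D' := by
  induction h generalizing D' with
  | refl => exact equivalent_of_represents hD hD'
  | tail _ hm ih =>
    obtain ⟨E, E', hE, hE', hX⟩ := hm
    exact (ih hE).trans (Equivalent.trans (.rel _ _ (Or.inr hX)) (equivalent_of_represents hE' hD'))

theorem xiEquiv_of_equivalent {D D' : GaussDiagram} (h : D.Equivalent D') :
    XiEquiv (Quotient.mk _ D) (Quotient.mk _ D') := by
  induction h with
  | rel D D' h =>
    rcases h with h | h
    · rw [Quotient.sound (s := reidemeisterSetoid) (.rel _ _ h)]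
      exact .refl
    · exact .single ⟨D, D', rfl, rfl, h⟩
  | refl => exact .refl
  | symm _ _ _ ih =>
    have : Std.Symm XiMove := ⟨fun _ _ => XiMove.symm⟩
    exact Std.Symm.symm (r := Relation.ReflTransGen XiMove) _ _ ih
  | trans _ _ _ _ _ ih₁ ih₂ => exact Relation.ReflTransGen.trans ih₁ ih₂

theorem xiEquiv_iff_equivalent {L L' : VirtualLink} {D D' : GaussDiagram} (hD : D.Represents L)
    (hD' : D'.Represents L') : L.XiEquiv L' ↔ D.Equivalent D' :=
  ⟨fun h => h.equivalent hD hD', fun h => by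
    have := xiEquiv_of_equivalent h
    rwa [show Quotient.mk _ D = L from hD, show Quotient.mk _ D' = L' from hD'] at this⟩

theorem IsEven.circlesEven {L : VirtualLink} (h : L.IsEven) {D : GaussDiagram}
    (hD : D.Represents L) : D.CirclesEven := by
  obtain ⟨E, hE, he⟩ := h
  exact (equivalent_of_represents hE hD).sameInvariants.1.1 he.circlesEven

end VirtualLink

/-- Let `L` and `L'` be even 2-component virtual links, and compute the invariants of `L` and of
`L'` from any Gauss diagrams `G`, `G'` of them, and the reduced linking classes `F`, `F'` from any
nonself-chords in these. (For `L = L'` this includes that the choices do not matter.) -/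
theorem theorem1p3 (L L' : VirtualLink) (hL : L.IsEven) (hL' : L'.IsEven)
    (G G' : GaussDiagram) (hG : G.Represents L) (hG' : G'.Represents L')
    (F F' : LinkingClass) (hF : G.IsReducedLinkingClass F) (hF' : G'.IsReducedLinkingClass F') :
    L.XiEquiv L' ↔
      G.oddWrithe 0 = G'.oddWrithe 0 ∧ G.oddWrithe 1 = G'.oddWrithe 1 ∧ F = F' := by
  rw [VirtualLink.xiEquiv_iff_equivalent hG hG',
    GaussDiagram.equivalent_iff (hL.circlesEven hG) (hL'.circlesEven hG'), hF.eq, hF'.eq,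
    GaussDiagram.mk_linkingNumbers_eq_mk_iff]
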